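/- **Conventions.** Computation is in the bit model, and a *randomized polynomial-time* sequence of tests means a sequence of randomized Boolean circuits (NOT, AND, OR gates of fan-in at most two, constants, fair coins) of size polynomial in the input size; no uniformity in the index is required. For graphs on $m$ vertices the input is the adjacency matrix and the size is polynomial in $m$. For functions $\psi_n:\mathbb R^{n\times p_n}\to\{0,1\}$, each real entry is read through a measurable representation $\mathbb R\to\{0,1\}^{b_n}$, and $b_n$, the number of coins and the circuit size are polynomial in $np_n$. **Planted graphs.** For a graph $H$ on $\kappa\le m$ vertices let $\mathbf P_H$ be the law of the random graph on $m$ vertices obtained by planting a copy of $H$ along a uniformly random injection of its vertices and joining every pair of vertices not both in the image independently with probability $1/2$; $\mathbf P_0$ is the Erdős–Rényi law $G(m,1/2)$. For $\epsilon\in(0,1/2]$ let $\mathcal H_{\kappa,\epsilon}$ be the set of graphs $H$ on $\kappa$ vertices with $\#E(H)\ge(1/2+\epsilon)\kappa(\kappa-1)/2$. **Assumption (A1) with parameter $\epsilon\in(0,1/2]$.** For every $\delta\in(0,1/2)$, every sequence of integers $\kappa_m\to\infty$ with $\kappa_m=O(m^{1/2-\delta})$, and every sequence of randomized polynomial-time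 tests $\phi_m$ on graphs with $m$ vertices, $$\liminf_{m\to\infty}\Bigl\{\mathbf P_0(\phi_m(G)=1)+\max_{H\in\mathcal H_{\kappa_m,\epsilon}}\mathbf P_H(\phi_m(G)=0)\Bigr\}>\frac13 .$$ **Certifiers.** A matrix $X\in\mathbb R^{n\times p}$ is in $\mathrm{RIP}_{n,p}(k,\theta)$ if $1-\theta\le\|Xu\|_2^2\le1+\theta$ for all $u\in\mathbb R^p$ with $\|u\|_2=1$ and at most $k$ non-zero coordinates. Fix $\sigma$ and let $\mathcal Q=\mathcal Q_\sigma$ be the set of probability distributions $Q$ on $\mathbb R$ with mean zero, variance one and $\int e^{\lambda x}\,dQ(x)\le e^{\lambda^2\sigma^2/2}$ for all $\lambda\in\mathbb R$; let $\tilde Q$ be the law of $Z/\sqrt n$, $Z\sim Q$. For a parameter sequence $(p_n,k_n,\theta_n)$, a randomized polynomial-time certifier for $Q$ is a randomized polynomial-time sequence $\psi_n:\mathbb R^{n\times p_n}\to\{0,1\}$ such that $\psi_n(X)=1$ (for any outcome of the coins) implies $X\in\mathrm{RIP}_{n,p_n}(k_n,\theta_n)$, and $\limsup_{n\to\infty}\mathbb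 P(\psi_n(X)=0)\le1/3$ when $X\sim\tilde Q^{\otimes(n\times p_n)}$. For $\alpha\in[0,1]$, $\mathcal R_\alpha$ is the set of sequences $(p_n,k_n,\theta_n)$ with $1\le k_n\le p_n$, $\theta_n\in(0,1)$, $p_n,k_n\to\infty$ and $k_n^{1+\alpha}\log(p_n)/\theta_n^2=o(n)$. **Theorem.** Assume (A1) with some parameter $\epsilon\in(0,1/2]$ and fix any $\alpha\in[0,1)$. Then there exists a sequence $(p_n,k_n,\theta_n)\in\mathcal R_\alpha$ such that there is no pair $(\psi,Q)$ in which $Q\in\mathcal Q$ and $\psi$ is a randomized polynomial-time certifier for $Q$ with respect to this sequence of parameters. -/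

import Mathlib

open MeasureTheory ProbabilityTheory Filter Asymptotics Topology
open scoped ENNReal NNReal

noncomputable section

namespace RIPHardness

/-! ### Boolean circuits and randomized polynomial-time computation -/

/-- A Boolean circuit on input variables indexed by `ι`, as a straight-line program: the list of
its gates (last gate first), each gate recorded by the Boolean function of the inputs that it
computes. Each gate is an input variable, a constant, or a NOT / AND / OR of earlier gates. -/
inductive IsCircuit {ι : Type} : List ((ι → Bool) → Bool) → Prop
  | nil : IsCircuit []
  | input {L : List ((ι → Bool) → Bool)} (i : ι) (hL : IsCircuit L) :
      IsCircuit ((fun x => x i) :: L)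
  | const {L : List ((ι → Bool) → Bool)} (b : Bool) (hL : IsCircuit L) :
      IsCircuit ((fun _ => b) :: L)
  | not {L : List ((ι → Bool) → Bool)} {f : (ι → Bool) → Bool} (hL : IsCircuit L) (hf : f ∈ L) :
      IsCircuit ((fun x => !(f x)) :: L)
  | and {L : List ((ι → Bool) → Bool)} {f g : (ι → Bool) → Bool} (hL : IsCircuit L)
      (hf : f ∈ L) (hg : g ∈ L) : IsCircuit ((fun x => f x && g x) :: L)
  | or {L : List ((ι → Bool) → Bool)} {f g : (ι → Bool) → Bool} (hL : IsCircuit L)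
      (hf : f ∈ L) (hg : g ∈ L) : IsCircuit ((fun x => f x || g x) :: L)

/-- `f` is computed by a Boolean circuit with at most `s` gates. -/
def ComputableInSize {ι : Type} (f : (ι → Bool) → Bool) (s : ℕ) : Prop :=
  ∃ L : List ((ι → Bool) → Bool), IsCircuit L ∧ f ∈ L ∧ L.length ≤ s

/-- The law of `r` independent fair coins. -/
def coinLaw (r : ℕ) : Measure (Fin r → Bool) := uniformOn Set.univ

open Classical in
/-- The adjacency matrix of a graph, as a string of bits. -/
def adjBits {m : ℕ} (G : SimpleGraph (Fin m)) : Fin m × Fin m → Bool :=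
  fun e => decide (G.Adj e.1 e.2)

/-- A sequence of randomized polynomial-time tests `φ_m` on graphs with `m` vertices: on input
the adjacency matrix of the graph and polynomially many fair coins, `φ_m` evaluates a Boolean
circuit whose size is polynomial in `m`. -/
structure RandPolyTest where
  /-- number of coins used by the `m`-th test -/
  coins : ℕ → ℕ
  /-- output on a given graph and given outcomes of the coins -/
  run : ∀ m : ℕ, SimpleGraph (Fin m) → (Fin (coins m) → Bool) → Bool
  polyTime : ∃ c : ℕ, ∀ m : ℕ, coins m ≤ m ^ c + c ∧
    ∃ C : ((Fin m × Fin m) ⊕ Fin (coins m) → Bool) → Bool,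
      ComputableInSize C (m ^ c + c) ∧
        ∀ G ω, run m G ω = C (Sum.elim (adjBits G) ω)

/-- The probability that the test `φ_m` outputs `b` on a random graph with law `P`. -/
def RandPolyTest.prob (φ : RandPolyTest) (m : ℕ) (P : Measure (SimpleGraph (Fin m))) (b : Bool) :
    ℝ≥0∞ :=
  (P.prod (coinLaw (φ.coins m))) {x | φ.run m x.1 x.2 = b}

/-- A sequence of randomized polynomial-time functions `ψ_n` from `n × p_n` real matrices to
`{0,1}`. Each real entry is read through a measurable finite-precision representation with
polynomially many bits; on these bits and polynomially many fair coins, `ψ_n` evaluates a Boolean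
circuit. Polynomial means polynomial in the number `n * p_n` of entries. -/
structure RandPolyMatrixTest (p : ℕ → ℕ) where
  /-- number of coins used by the `n`-th function -/
  coins : ℕ → ℕ
  /-- number of bits by which each entry is represented -/
  bits : ℕ → ℕ
  /-- the finite-precision representation of a real number -/
  enc : ∀ n : ℕ, ℝ → Fin (bits n) → Bool
  enc_measurable : ∀ n, Measurable (enc n)
  /-- output on a given matrix and given outcomes of the coins -/
  run : ∀ n : ℕ, Matrix (Fin n) (Fin (p n)) ℝ → (Fin (coins n) → Bool) → Bool
  polyTime : ∃ c : ℕ, ∀ n : ℕ, coins n ≤ (n * p n) ^ c + c ∧ bits n ≤ (n * p n) ^ c + c ∧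
    ∃ C : (((Fin n × Fin (p n)) × Fin (bits n)) ⊕ Fin (coins n) → Bool) → Bool,
      ComputableInSize C ((n * p n) ^ c + c) ∧
        ∀ X ω, run n X ω = C (Sum.elim (fun q => enc n (X q.1.1 q.1.2) q.2) ω)

/-! ### Planted dense subgraphs -/

/-- The Erdős–Rényi law `G(m, 1/2)`. -/
def erdosRenyi (m : ℕ) : Measure (SimpleGraph (Fin m)) :=
  SimpleGraph.binomialRandom (Fin m) ⟨1 / 2, by norm_num, by norm_num⟩

/-- Replace the edges of `G` within the range of `e` by those of the copy of `H` under `e`. -/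
def plant {κ m : ℕ} (H : SimpleGraph (Fin κ)) (e : Fin κ ↪ Fin m) (G : SimpleGraph (Fin m)) :
    SimpleGraph (Fin m) :=
  H.map e ⊔ (G \ (⊤ : SimpleGraph (Fin κ)).map e)

/-- The law `𝒢(m, 1/2, H)`: `H` is planted along a uniformly random injection of its vertices,
all other pairs are edges independently with probability `1/2`. (Meaningful for `κ ≤ m`.) -/
def plantedLaw (m : ℕ) {κ : ℕ} (H : SimpleGraph (Fin κ)) : Measure (SimpleGraph (Fin m)) :=
  (Fintype.card (Fin κ ↪ Fin m) : ℝ≥0∞)⁻¹ •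
    ∑ e : Fin κ ↪ Fin m, (erdosRenyi m).map (plant H e)

/-- The graphs on `κ` vertices with edge density at least `1/2 + ε`. -/
def denseGraphs (κ : ℕ) (ε : ℝ) : Set (SimpleGraph (Fin κ)) :=
  {H | (1 / 2 + ε) * ((κ : ℝ) * ((κ : ℝ) - 1) / 2) ≤ (H.edgeSet.ncard : ℝ)}

/-- The hardness assumption for detecting planted graphs of edge density at least `1/2 + ε`. -/
def PlantedDenseHardness (ε : ℝ) : Prop :=
  ∀ δ : ℝ, 0 < δ → δ < 1 / 2 → ∀ κ : ℕ → ℕ, Tendsto κ atTop atTop →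
    (fun m => (κ m : ℝ)) =O[atTop] (fun m : ℕ => (m : ℝ) ^ (1 / 2 - δ)) →
    ∀ φ : RandPolyTest,
      1 / 3 < liminf (fun m : ℕ => φ.prob m (erdosRenyi m) true +
        ⨆ H ∈ denseGraphs (κ m) ε, φ.prob m (plantedLaw m H) false) atTop

/-! ### Restricted isometry and its certification -/

/-- The restricted isometry property with sparsity `k` and distortion `θ`. -/
def RIP {n p : ℕ} (k : ℕ) (θ : ℝ) (X : Matrix (Fin n) (Fin p) ℝ) : Prop :=
  ∀ u : EuclideanSpace ℝ (Fin p), ‖u‖ = 1 → {j | u j ≠ 0}.ncard ≤ k →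
    1 - θ ≤ ‖WithLp.toLp 2 (X.mulVec u.ofLp)‖ ^ 2 ∧ ‖WithLp.toLp 2 (X.mulVec u.ofLp)‖ ^ 2 ≤ 1 + θ

/-- The distributions on `ℝ` with mean zero, unit variance and sub-Gaussian parameter at most `σ`,
i.e. `∫ exp (t x) dQ(x) ≤ exp (σ² t² / 2)` for all real `t`. -/
def subGaussianClass (σ : ℝ≥0) : Set (Measure ℝ) :=
  {Q | IsProbabilityMeasure Q ∧ ∫ x, x ∂Q = 0 ∧ Var[id; Q] = 1 ∧ HasSubgaussianMGF id (σ ^ 2) Q}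

/-- The law of an `n × p` matrix whose entries are i.i.d. copies of `Z / √n` with `Z ∼ Q`. -/
def designLaw (Q : Measure ℝ) (n p : ℕ) : Measure (Fin n → Fin p → ℝ) :=
  Measure.pi fun _ => Measure.pi fun _ => Q.map fun z => z / √(n : ℝ)

/-- The asymptotic regime `n ≫ k^(1+α) log p / θ²`, `p, k → ∞`. -/
structure InRegime (α : ℝ) (p k : ℕ → ℕ) (θ : ℕ → ℝ) : Prop where
  sparsity : ∀ n, 1 ≤ k n ∧ k n ≤ p n
  distortion : ∀ n, 0 < θ n ∧ θ n < 1
  tendsto_p : Tendsto p atTop atTop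
  tendsto_k : Tendsto k atTop atTop
  sampleSize : (fun n => (k n : ℝ) ^ (1 + α) * Real.log (p n) / θ n ^ 2) =o[atTop]
    (fun n : ℕ => (n : ℝ))

/-- `ψ` is a certifier of the restricted isometry property for random design matrices with entry
distribution `Q`: it never accepts a matrix without the property, and asymptotically it rejects a
random design matrix with probability at most `1/3`. -/
structure IsCertifier (Q : Measure ℝ) (p k : ℕ → ℕ) (θ : ℕ → ℝ) (ψ : RandPolyMatrixTest p) :
    Prop where
  sound : ∀ n X ω, ψ.run n X ω = true → RIP (k n) (θ n) X
  complete : limsup (fun n => ((designLaw Q n (p n)).prod (coinLaw (ψ.coins n)))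
    {x | ψ.run n (Matrix.of x.1) x.2 = false}) atTop ≤ 1 / 3

end RIPHardness

end

noncomputable section

namespace RIPHardness

/-! ### Circuits -/

/-! A certifier for `Q` would yield a test for planted dense graphs. Split `Q` as the average of two
laws `ρ true`, `ρ false` with means `c` and `-c`, `c > 0` (`exists_tilt`). From a graph on `n + 1`
vertices build an `n × (n + 1)` matrix whose entry above the diagonal is drawn from `ρ` of the
corresponding edge bit, all other entries from `Q`. For `G(n + 1, 1/2)` the entries are exactly
i.i.d. `Q` (`lintegral_graphLaw`), so the certifier mostly accepts.

If a dense graph on `κ` vertices is planted on `T`, the entries in rows and columns of `T` have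
means summing to at least `c ε κ (κ - 1)`. Along the unit vector `1_T / √κ` this adds order `κ³` to
the sum of squared row sums, against a typical size `n κ`, an allowance `n κ θ` and fluctuations `√n
κ` (`measure_sum_sq_le`). With `κ ≈ n^(1/2 - δ)` and `θ ≈ n^(-3δ)` the excess wins, the restricted
isometry property fails, and soundness forces rejection. Taking `16 δ = 1 - α` keeps these
parameters in the regime; they depend on `α` alone, so one sequence defeats every `Q` and `ψ`.

Real entries cannot be sampled with fair coins. Since circuits are non-uniform, a polynomial table
of seeds (candidate entries together with the coins of the certifier) is hardwired instead.
Hoeffding's inequality and a union bound over all graphs give a table accurate on every graph at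
once (`exists_seeds`), and the coins of the test only select a seed (`exists_graph_test`). -/

lemma IsCircuit.append {ι : Type} {L L' : List ((ι → Bool) → Bool)} (hL : IsCircuit L)
    (hL' : IsCircuit L') : IsCircuit (L ++ L') := by
  induction hL with
  | nil => simpa using hL'
  | input i _ ih => exact .input i ih
  | const b _ ih => exact .const b ih
  | not _ hf ih => exact .not ih (List.mem_append_left _ hf)
  | and _ hf hg ih => exact .and ih (List.mem_append_left _ hf) (List.mem_append_left _ hg)
  | or _ hf hg ih => exact .or ih (List.mem_append_left _ hf) (List.mem_append_left _ hg)

namespace ComputableInSize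

variable {ι ι' α : Type} {f g : (ι → Bool) → Bool} {s t : ℕ}

lemma mono (h : ComputableInSize f s) (hst : s ≤ t) : ComputableInSize f t := by
  obtain ⟨L, h1, h2, h3⟩ := h
  exact ⟨L, h1, h2, h3.trans hst⟩

lemma const (b : Bool) : ComputableInSize (fun _ : ι → Bool => b) 1 :=
  ⟨_, .const b .nil, by simp, by simp⟩

lemma input (i : ι) : ComputableInSize (fun x : ι → Bool => x i) 1 :=
  ⟨_, .input i .nil, by simp, by simp⟩

lemma not (h : ComputableInSize f s) : ComputableInSize (fun x => !(f x)) (s + 1) := by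
  obtain ⟨L, h1, h2, h3⟩ := h
  exact ⟨_, .not h1 h2, by simp, by simpa using h3⟩

lemma and (hf : ComputableInSize f s) (hg : ComputableInSize g t) :
    ComputableInSize (fun x => f x && g x) (s + t + 1) := by
  obtain ⟨L, h1, h2, h3⟩ := hf
  obtain ⟨L', h1', h2', h3'⟩ := hg
  refine ⟨_, .and (h1.append h1') (List.mem_append_left _ h2) (List.mem_append_right _ h2'),
    by simp, ?_⟩
  simp only [List.length_cons, List.length_append]
  omega

lemma or (hf : ComputableInSize f s) (hg : ComputableInSize g t) :
    ComputableInSize (fun x => f x || g x) (s + t + 1) := by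
  obtain ⟨L, h1, h2, h3⟩ := hf
  obtain ⟨L', h1', h2', h3'⟩ := hg
  refine ⟨_, .or (h1.append h1') (List.mem_append_left _ h2) (List.mem_append_right _ h2'),
    by simp, ?_⟩
  simp only [List.length_cons, List.length_append]
  omega

lemma any (l : List α) (F : α → (ι → Bool) → Bool) (hF : ∀ a ∈ l, ComputableInSize (F a) s) :
    ComputableInSize (fun x => l.any fun a => F a x) (l.length * (s + 1) + 1) := by
  induction l with
  | nil => simpa using const false
  | cons a l ih =>
    have h := (hF a (by simp)).or (ih fun b hb => hF b (by simp [hb]))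
    simp only [List.any_cons, List.length_cons]
    exact h.mono (by ring_nf; omega)

lemma all (l : List α) (F : α → (ι → Bool) → Bool) (hF : ∀ a ∈ l, ComputableInSize (F a) s) :
    ComputableInSize (fun x => l.all fun a => F a x) (l.length * (s + 1) + 1) := by
  induction l with
  | nil => simpa using const true
  | cons a l ih =>
    have h := (hF a (by simp)).and (ih fun b hb => hF b (by simp [hb]))
    simp only [List.all_cons, List.length_cons]
    exact h.mono (by ring_nf; omega)

/-- Substituting small circuits for the inputs of a circuit. -/
lemma subst {C : (ι → Bool) → Bool} {c : ℕ} (h : ComputableInSize C s)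
    (g : ι → (ι' → Bool) → Bool) (hg : ∀ i, ComputableInSize (g i) c) (hc : 1 ≤ c) :
    ComputableInSize (fun x => C fun i => g i x) (s * c) := by
  obtain ⟨L, hL, hC, hs⟩ := h
  -- The induction carries all gates of `L`, not only the output, because later gates refer to
  -- earlier ones. Only input gates cost `c`; the others cost `1 ≤ c`.
  suffices H : ∃ L' : List ((ι' → Bool) → Bool), IsCircuit L' ∧
      (∀ f ∈ L, (fun x => f fun i => g i x) ∈ L') ∧ L'.length ≤ L.length * c by
    obtain ⟨L', h1, h2, h3⟩ := H
    exact ⟨L', h1, h2 _ hC, h3.trans (Nat.mul_le_mul_right _ hs)⟩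
  clear hC hs
  induction hL with
  | nil => exact ⟨[], .nil, by simp, by simp⟩
  | input i _ ih =>
    obtain ⟨L', h1, h2, h3⟩ := ih
    obtain ⟨M, m1, m2, m3⟩ := hg i
    refine ⟨M ++ L', m1.append h1, ?_, ?_⟩
    · intro f hf
      rcases List.mem_cons.1 hf with rfl | hf
      · exact List.mem_append_left _ m2
      · exact List.mem_append_right _ (h2 f hf)
    · simp only [List.length_cons, List.length_append, add_mul]
      omega
  | const b _ ih =>
    obtain ⟨L', h1, h2, h3⟩ := ih
    refine ⟨_, h1.const b, ?_, ?_⟩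
    · intro f hf
      rcases List.mem_cons.1 hf with rfl | hf
      · simp
      · exact List.mem_cons_of_mem _ (h2 f hf)
    · simp only [List.length_cons, add_mul]
      omega
  | not _ hf ih =>
    obtain ⟨L', h1, h2, h3⟩ := ih
    refine ⟨_, h1.not (h2 _ hf), ?_, ?_⟩
    · intro f hf
      rcases List.mem_cons.1 hf with rfl | hf
      · simp
      · exact List.mem_cons_of_mem _ (h2 f hf)
    · simp only [List.length_cons, add_mul]
      omega
  | and _ hf hg ih =>
    obtain ⟨L', h1, h2, h3⟩ := ih
    refine ⟨_, h1.and (h2 _ hf) (h2 _ hg), ?_, ?_⟩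
    · intro f hf
      rcases List.mem_cons.1 hf with rfl | hf
      · simp
      · exact List.mem_cons_of_mem _ (h2 f hf)
    · simp only [List.length_cons, add_mul]
      omega
  | or _ hf hg ih =>
    obtain ⟨L', h1, h2, h3⟩ := ih
    refine ⟨_, h1.or (h2 _ hf) (h2 _ hg), ?_, ?_⟩
    · intro f hf
      rcases List.mem_cons.1 hf with rfl | hf
      · simp
      · exact List.mem_cons_of_mem _ (h2 f hf)
    · simp only [List.length_cons, add_mul]
      omega

/-- A Boolean function of one input variable. -/
lemma ofBit (i : ι) (b₁ b₀ : Bool) :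
    ComputableInSize (fun x : ι → Bool => if x i then b₁ else b₀) 2 := by
  cases b₁ <;> cases b₀
  · simpa using (const (ι := ι) false).mono one_le_two
  · simpa using (input i).not
  · simpa using (input i).mono one_le_two
  · simpa using (const (ι := ι) true).mono one_le_two

/-- Selecting one of finitely many circuits by means of `r` input bits. -/
lemma select {κ : Type} {r : ℕ} (C : (Fin r → Bool) → (κ → Bool) → Bool)
    (hC : ∀ a, ComputableInSize (C a) s) :
    ComputableInSize (fun x : κ ⊕ Fin r → Bool => C (fun i => x (.inr i)) fun i => x (.inl i))
      (2 ^ r * (s + 3 * r + 3) + 1) := by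
  -- A disjunction over all `2 ^ r` strings `a` of "the selector bits equal `a`" (size `3 * r + 1`)
  -- and `C a` (size `s`).
  have key := any (s := s + 3 * r + 2) (Finset.univ : Finset (Fin r → Bool)).toList
    (fun a (x : κ ⊕ Fin r → Bool) => ((List.finRange r).all fun i =>
      if x (.inr i) then a i else !(a i)) && C a fun i => x (.inl i)) ?_
  · have hl : (Finset.univ : Finset (Fin r → Bool)).toList.length = 2 ^ r := by simp
    rw [hl] at key
    convert key using 1
    funext x
    rw [Bool.eq_iff_iff]
    simp only [List.any_eq_true, Finset.mem_toList, Finset.mem_univ, true_and, Bool.and_eq_true,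
      List.all_eq_true, List.mem_finRange, forall_true_left]
    constructor
    · intro h
      exact ⟨_, fun i => by cases x (.inr i) <;> simp, h⟩
    · rintro ⟨a, h1, h2⟩
      have : (fun i => x (.inr i)) = a := by
        funext i
        have := h1 i
        cases hx : x (.inr i) <;> simp_all
      rwa [this]
  · intro a _
    have h1 := all (s := 2) (List.finRange r)
      (fun i (x : κ ⊕ Fin r → Bool) => if x (.inr i) then a i else !(a i))
      (fun i _ => ofBit _ _ _)
    have h2 := (hC a).subst (fun i (x : κ ⊕ Fin r → Bool) => x (.inl i))
      (fun i => input _) le_rfl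
    refine (h1.and h2).mono ?_
    simp only [List.length_finRange]
    omega

end ComputableInSize

/-! ### Polynomially bounded sequences -/

/-- The sequence `f` is bounded by a polynomial. -/
def PolyBounded (f : ℕ → ℕ) : Prop := ∃ C d, ∀ m, f m ≤ C * (m + 1) ^ d

namespace PolyBounded

variable {f g : ℕ → ℕ}

lemma const (C : ℕ) : PolyBounded fun _ => C := ⟨C, 0, by simp⟩

lemma id : PolyBounded fun m => m := ⟨1, 1, by simp⟩

lemma mul (hf : PolyBounded f) (hg : PolyBounded g) : PolyBounded fun m => f m * g m := by
  obtain ⟨C, d, hf⟩ := hf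
  obtain ⟨C', d', hg⟩ := hg
  refine ⟨C * C', d + d', fun m => (Nat.mul_le_mul (hf m) (hg m)).trans_eq ?_⟩
  ring

lemma add (hf : PolyBounded f) (hg : PolyBounded g) : PolyBounded fun m => f m + g m := by
  obtain ⟨C, d, hf⟩ := hf
  obtain ⟨C', d', hg⟩ := hg
  refine ⟨C + C', d + d', fun m => (Nat.add_le_add (hf m) (hg m)).trans ?_⟩
  rw [add_mul]
  gcongr <;> omega

lemma pow (hf : PolyBounded f) (c : ℕ) : PolyBounded fun m => f m ^ c := by
  induction c with
  | zero => simpa using const 1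
  | succ c ih => simpa only [pow_succ] using ih.mul hf

/-- The additive constant handles `m < 2`; for `m ≥ 2` constants are absorbed by `C ≤ m ^ C`.
Allowing every `c' ≥ c` lets several bounds share one exponent. -/
lemma exists_le_pow_add (hf : PolyBounded f) : ∃ c, ∀ c' ≥ c, ∀ m, f m ≤ m ^ c' + c' := by
  obtain ⟨C, d, h⟩ := hf
  refine ⟨C * 2 ^ d + C + 2 * d, fun c hc m => (h m).trans ?_⟩
  rcases Nat.lt_or_ge m 2 with hm | hm
  · have : (m + 1) ^ d ≤ 2 ^ d := Nat.pow_le_pow_left (by omega) d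
    have := Nat.mul_le_mul_left C this
    omega
  · have h1 : (m + 1) ^ d ≤ (m ^ 2) ^ d := Nat.pow_le_pow_left (by nlinarith) d
    have h2 : C ≤ m ^ C := (Nat.lt_pow_self hm).le
    calc C * (m + 1) ^ d ≤ m ^ C * (m ^ 2) ^ d := Nat.mul_le_mul h2 h1
      _ = m ^ (C + 2 * d) := by rw [← pow_mul, pow_add]
      _ ≤ m ^ c := Nat.pow_le_pow_right (by omega) (by omega)
      _ ≤ _ := by omega

end PolyBounded

/-! ### Replacing internal randomness by a small table of seeds -/

/-- Hoeffding's inequality and a union bound: a table of i.i.d. seeds represents the acceptance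
probabilities on all inputs simultaneously. -/
lemma exists_seeds {Ω : Type*} [MeasurableSpace Ω] (ν : Measure Ω) [IsProbabilityMeasure ν]
    {γ A : Type*} [Fintype γ] [Fintype A] [Nonempty A] (F : γ → Ω → Bool)
    (hF : ∀ g, Measurable (F g))
    {η : ℝ} (hη : 0 < η)
    (hcard : 2 * Fintype.card γ * Real.exp (-(2 * Fintype.card A * η ^ 2)) < 1) :
    ∃ s : A → Ω, ∀ g b, ((Finset.univ.filter fun a => F g (s a) = b).card : ℝ) ≤
      Fintype.card A * (ν.real {x | F g x = b} + η) := by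
  classical
  set P : Measure (A → Ω) := Measure.pi fun _ => ν
  have hms : ∀ g b, MeasurableSet {x | F g x = b} := fun g b => hF g (MeasurableSet.singleton b)
  let Y : γ × Bool → Ω → ℝ := fun q => {x | F q.1 x = q.2}.indicator 1
  have hY : ∀ q, Measurable (Y q) := fun q => measurable_one.indicator (hms _ _)
  let S : γ × Bool → (A → Ω) → ℝ := fun q s => ∑ a, (Y q (s a) - ν.real {x | F q.1 x = q.2})
  have hN : (0 : ℝ) < Fintype.card A := by exact_mod_cast Fintype.card_pos
  have hbad : ∀ q, P.real {s | Fintype.card A * η ≤ S q s} ≤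
      Real.exp (-(2 * Fintype.card A * η ^ 2)) := by
    intro q
    have hsub : ∀ a : A, HasSubgaussianMGF
        (fun s : A → Ω => Y q (s a) - ν.real {x | F q.1 x = q.2}) ((‖(1 : ℝ) - 0‖₊ / 2) ^ 2) P := by
      intro a
      have h := hasSubgaussianMGF_of_mem_Icc (μ := ν) (X := Y q) (a := 0) (b := 1)
        (hY q).aemeasurable (ae_of_all _ fun x => by
          by_cases hx : F q.1 x = q.2 <;> simp [Y, hx])
      have hint : ν[Y q] = ν.real {x | F q.1 x = q.2} := by
        simp only [Y]
        exact integral_indicator_one (hms _ _)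
      rw [hint] at h
      refine HasSubgaussianMGF.of_map (Y := fun s : A → Ω => s a)
        (measurable_pi_apply a).aemeasurable
        (X := fun x => Y q x - ν.real {x | F q.1 x = q.2}) ?_
      have hm : P.map (fun s : A → Ω => s a) = ν := (measurePreserving_eval (fun _ => ν) a).map_eq
      rwa [hm]
    have hind : iIndepFun (fun (a : A) (s : A → Ω) => Y q (s a) - ν.real {x | F q.1 x = q.2}) P :=
      iIndepFun_pi (X := fun _ x => Y q x - ν.real {x | F q.1 x = q.2})
        fun a => ((hY q).sub_const _).aemeasurable
    refine (HasSubgaussianMGF.measure_sum_ge_le_of_iIndepFun (s := Finset.univ) hind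
      (fun a _ => hsub a) (ε := Fintype.card A * η) (by positivity)).trans_eq ?_
    congr 1
    simp
    field_simp
  -- The factor `2` in `hcard` counts the two values of the output bit `b`.
  have hsum : P.real (⋃ q, {s | Fintype.card A * η ≤ S q s}) < 1 := by
    refine (measureReal_iUnion_fintype_le _).trans_lt
      ((Finset.sum_le_sum fun q _ => hbad q).trans_lt ?_)
    simp only [Finset.sum_const, Finset.card_univ, Fintype.card_prod, Fintype.card_bool,
      nsmul_eq_mul]
    push_cast
    linarith
  have hne : (⋃ q, {s | Fintype.card A * η ≤ S q s}) ≠ Set.univ := by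
    intro h
    rw [h] at hsum
    simp at hsum
  obtain ⟨s, hs⟩ := (Set.ne_univ_iff_exists_notMem _).1 hne
  refine ⟨s, fun g b => ?_⟩
  simp only [Set.mem_iUnion, Set.mem_ofPred_eq, not_exists, not_le] at hs
  have h := hs (g, b)
  have hc : ∑ a, Y (g, b) (s a) = ((Finset.univ.filter fun a => F g (s a) = b).card : ℝ) := by
    simp [Y, Set.indicator_apply]
  simp only [S, Finset.sum_sub_distrib, hc, Finset.sum_const, Finset.card_univ,
    nsmul_eq_mul] at h
  linarith

/-! ### Mixtures over the edges of a random graph -/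

instance (m : ℕ) : MeasurableSingletonClass (SimpleGraph (Fin m)) where
  measurableSet_singleton G := by
    refine ⟨{G.Adj}, MeasurableSet.singleton _, ?_⟩
    ext G'
    simp

instance (m : ℕ) : IsProbabilityMeasure (erdosRenyi m) := by
  unfold erdosRenyi; infer_instance

lemma erdosRenyi_singleton (m : ℕ) (G : SimpleGraph (Fin m)) :
    erdosRenyi m {G} = (2⁻¹ : ℝ≥0∞) ^ m.choose 2 := by
  classical
  have hle : G.edgeSet.ncard ≤ m.choose 2 := by
    have := G.card_edgeFinset_le_card_choose_two
    rwa [Fintype.card_fin, ← SimpleGraph.coe_edgeFinset, Set.ncard_coe_finset] at *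
  have h1 : (unitInterval.toNNReal ⟨1 / 2, by norm_num, by norm_num⟩ : ℝ≥0) = 2⁻¹ := by
    ext; simp
  have h2 : (unitInterval.toNNReal (unitInterval.symm ⟨1 / 2, by norm_num, by norm_num⟩) : ℝ≥0)
      = 2⁻¹ := by
    ext; simp; norm_num
  rw [erdosRenyi, SimpleGraph.binomialRandom_singleton, h1, h2]
  rw [← pow_add, Nat.card_fin, Nat.add_sub_cancel' hle]
  simp

lemma lintegral_erdosRenyi (m : ℕ) (f : SimpleGraph (Fin m) → ℝ≥0∞) :
    ∫⁻ G, f G ∂erdosRenyi m = (Fintype.card (SimpleGraph (Fin m)) : ℝ≥0∞)⁻¹ * ∑ G, f G := by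
  have h : ∀ f : SimpleGraph (Fin m) → ℝ≥0∞,
      ∫⁻ G, f G ∂erdosRenyi m = (2⁻¹ : ℝ≥0∞) ^ m.choose 2 * ∑ G, f G := by
    intro f
    rw [lintegral_fintype, Finset.mul_sum]
    simp only [erdosRenyi_singleton, mul_comm]
  -- Total mass one identifies the common weight of the graphs without counting them.
  have h1 := h fun _ => 1
  simp only [lintegral_one, measure_univ, Finset.sum_const, Finset.card_univ, nsmul_eq_mul,
    mul_one] at h1
  rw [h, ENNReal.eq_inv_of_mul_eq_one_left h1.symm]

/-- The positions of an `n × (n + 1)` matrix above the diagonal, i.e. the pairs of vertices of a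
graph on `n + 1` vertices. -/
abbrev UpperPair (n : ℕ) : Type := {q : Fin n × Fin (n + 1) // q.1.castSucc < q.2}

open Classical in
lemma bijective_upperBits (n : ℕ) : Function.Bijective
    fun (G : SimpleGraph (Fin (n + 1))) (q : UpperPair n) => decide (G.Adj q.1.1.castSucc q.1.2) := by
  have hex : ∀ a b : Fin (n + 1), a < b → ∃ i : Fin n, i.castSucc = a := fun a b hab =>
    ⟨a.castPred (Fin.ne_last_of_lt hab), by simp⟩
  constructor
  · intro G G' h
    have key : ∀ a b, a < b → (G.Adj a b ↔ G'.Adj a b) := by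
      intro a b hab
      obtain ⟨i, rfl⟩ := hex a b hab
      simpa using congrFun h ⟨(i, b), hab⟩
    ext a b
    rcases lt_trichotomy a b with hab | rfl | hab
    · exact key a b hab
    · simp
    · rw [G.adj_comm, G'.adj_comm]
      exact key b a hab
  · intro x
    refine ⟨SimpleGraph.fromRel fun a b => ∃ i : Fin n, a = i.castSucc ∧
      ∃ h : i.castSucc < b, x ⟨(i, b), h⟩ = true, ?_⟩
    funext ⟨⟨i, j⟩, h⟩
    rw [Bool.eq_iff_iff]
    refine (@decide_eq_true_iff _ (Classical.propDecidable _)).trans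
      ((SimpleGraph.fromRel_adj _ _ _).trans ?_)
    constructor
    · rintro ⟨-, ⟨i', hi, h', hx⟩ | ⟨i', hi, h', hx⟩⟩
      · obtain rfl := Fin.castSucc_injective _ hi
        exact hx
      · simp only at hi h h'
        rw [hi] at h
        exact absurd h' (not_lt.2 h.le)
    · intro hx
      exact ⟨h.ne, .inl ⟨i, rfl, h, hx⟩⟩

-- Bits above the diagonal are independent fair coins, so the expectation factorises. Positions on
-- or below the diagonal would reuse a bit or read a loop, hence `hr` makes them ignore it.
open Classical in
lemma lintegral_prod_edges (n : ℕ) (r : Fin n → Fin (n + 1) → Bool → ℝ≥0∞)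
    (hr : ∀ i j, ¬ i.castSucc < j → r i j true = r i j false) :
    ∫⁻ G, ∏ i, ∏ j, r i j (decide (G.Adj i.castSucc j)) ∂erdosRenyi (n + 1) =
      ∏ i, ∏ j, 2⁻¹ * (r i j true + r i j false) := by
  have hsplit : ∀ f : Fin n → Fin (n + 1) → ℝ≥0∞, ∏ i, ∏ j, f i j =
      (∏ q : UpperPair n, f q.1.1 q.1.2) *
        ∏ q : {q : Fin n × Fin (n + 1) // ¬ q.1.castSucc < q.2}, f q.1.1 q.1.2 := by
    intro f
    rw [← Fintype.prod_prod_type', ← Fintype.prod_subtype_mul_prod_subtype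
      (fun q : Fin n × Fin (n + 1) => q.1.castSucc < q.2)]
  have hcard : (Fintype.card (SimpleGraph (Fin (n + 1))) : ℝ≥0∞) =
      2 ^ Fintype.card (UpperPair n) := by
    rw [Fintype.card_of_bijective (bijective_upperBits n)]
    simp
  have hlow : ∀ b : Bool, ∀ q : {q : Fin n × Fin (n + 1) // ¬ q.1.castSucc < q.2},
      r q.1.1 q.1.2 b = 2⁻¹ * (r q.1.1 q.1.2 true + r q.1.1 q.1.2 false) := by
    intro b q
    have h2 : r q.1.1 q.1.2 b = r q.1.1 q.1.2 false := by
      cases b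
      · rfl
      · exact hr _ _ q.2
    rw [hr _ _ q.2, h2, ← two_mul, ← mul_assoc, ENNReal.inv_mul_cancel (by simp) (by simp), one_mul]
  rw [lintegral_erdosRenyi, hcard]
  simp_rw [hsplit]
  rw [Finset.sum_congr rfl fun G _ => congrArg _ (Finset.prod_congr rfl fun q _ => hlow _ q)]
  rw [← Finset.sum_mul, ← mul_assoc]
  congr 1
  rw [Finset.prod_mul_distrib, Finset.prod_const, Finset.card_univ, ENNReal.inv_pow]
  congr 1
  have h1 := Finset.prod_univ_sum (fun _ : UpperPair n => (Finset.univ : Finset Bool))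
    (fun q b => r q.1.1 q.1.2 b)
  simp only [Fintype.univ_bool, Finset.mem_singleton, Bool.true_eq_false, not_false_eq_true,
    Finset.sum_insert, Finset.sum_singleton] at h1
  rw [h1]
  have h2 : (Fintype.piFinset fun _ : UpperPair n => ({true, false} : Finset Bool)) =
      Finset.univ := by ext; simp
  rw [h2]
  exact (bijective_upperBits n).sum_comp
    (fun x : UpperPair n → Bool => ∏ q : UpperPair n, r q.1.1 q.1.2 (x q))

/-- Product laws on matrices given row by row are determined by the measures of boxes. -/
lemma pi_pi_eq {n p : ℕ} (ρ : Fin n → Fin p → Measure ℝ) [∀ i j, IsProbabilityMeasure (ρ i j)]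
    (μ : Measure (Fin n → Fin p → ℝ))
    (h : ∀ s : Fin n → Fin p → Set ℝ, (∀ i j, MeasurableSet (s i j)) →
      μ (Set.pi Set.univ fun i => Set.pi Set.univ (s i)) = ∏ i, ∏ j, ρ i j (s i j)) :
    (Measure.pi fun i => Measure.pi (ρ i)) = μ := by
  refine Measure.pi_eq_generateFrom
    (C := fun _ => Set.pi Set.univ '' Set.pi Set.univ fun _ => {s : Set ℝ | MeasurableSet s})
    (fun _ => generateFrom_pi) (fun _ => isPiSystem_pi) (fun i => ?_) ?_
  · exact ⟨fun _ => Set.univ, fun _ => ⟨fun _ => Set.univ, by simp, by simp⟩, by simp,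
      Set.iUnion_const _⟩
  · intro s hs
    choose t ht hts using hs
    have : s = fun i => Set.pi Set.univ (t i) := funext fun i => (hts i).symm
    subst this
    rw [h t fun i j => ht i j (Set.mem_univ _)]
    simp [Measure.pi_pi]

open Classical in
/-- A matrix with independent entries whose laws depend on the edges of a random graph has
independent entries. -/
lemma lintegral_pi_edges {n : ℕ} (ρ : Fin n → Fin (n + 1) → Bool → Measure ℝ)
    [∀ i j b, IsProbabilityMeasure (ρ i j b)] (ν : Fin n → Fin (n + 1) → Measure ℝ)
    [∀ i j, IsProbabilityMeasure (ν i j)]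
    (hν : ∀ i j, (2⁻¹ : ℝ≥0∞) • (ρ i j true + ρ i j false) = ν i j)
    (hρ : ∀ i j, ¬ i.castSucc < j → ρ i j true = ρ i j false)
    {B : Set (Fin n → Fin (n + 1) → ℝ)} (hB : MeasurableSet B) :
    ∫⁻ G, (Measure.pi fun i => Measure.pi fun j => ρ i j (decide (G.Adj i.castSucc j))) B
      ∂erdosRenyi (n + 1) = (Measure.pi fun i => Measure.pi (ν i)) B := by
  set κ : SimpleGraph (Fin (n + 1)) → Measure (Fin n → Fin (n + 1) → ℝ) := fun G =>
    Measure.pi fun i => Measure.pi fun j => ρ i j (decide (G.Adj i.castSucc j))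
  have hκ : Measurable κ := measurable_of_finite _
  rw [← Measure.bind_apply hB hκ.aemeasurable]
  congr 1
  refine (pi_pi_eq ν _ fun s hs => ?_).symm
  rw [Measure.bind_apply (MeasurableSet.univ_pi fun i => MeasurableSet.univ_pi (hs i))
    hκ.aemeasurable]
  simp only [κ, Measure.pi_pi]
  rw [lintegral_prod_edges n (fun i j b => ρ i j b (s i j)) fun i j hij => by rw [hρ i j hij]]
  simp [← hν, mul_add]

/-! ### Splitting a centred law according to the sign -/

/-- To sample `ρ true`, draw from `Q`, keep a positive value and otherwise redraw once; for `ρ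
false` keep non-positive values. The redraw has mean zero, so `c` is the mean of the positive part.
It vanishes only if `Q` is concentrated at `0`. -/
lemma exists_tilt (Q : Measure ℝ) [IsProbabilityMeasure Q] (hint : Integrable (fun x : ℝ => x) Q)
    (hmean : ∫ x, x ∂Q = 0) (hvar : Var[id; Q] ≠ 0) :
    ∃ ρ : Bool → Measure ℝ, (∀ b, IsProbabilityMeasure (ρ b)) ∧
      (2⁻¹ : ℝ≥0∞) • (ρ true + ρ false) = Q ∧
      ∃ c : ℝ, 0 < c ∧ ∫ x, x ∂ρ true = c ∧ ∫ x, x ∂ρ false = -c := by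
  have hcompl : (Set.Ioi (0 : ℝ))ᶜ = Set.Iic 0 := Set.compl_Ioi
  have hadd : Q (Set.Ioi 0) + Q (Set.Iic 0) = 1 := by
    rw [← hcompl]; exact prob_add_prob_compl measurableSet_Ioi
  refine ⟨fun b => cond b (Q (Set.Iic 0) • Q + Q.restrict (Set.Ioi 0))
    (Q (Set.Ioi 0) • Q + Q.restrict (Set.Iic 0)), ?_, ?_,
    ∫ x in Set.Ioi 0, x ∂Q, ?_, ?_, ?_⟩
  · rintro (_ | _) <;> constructor
    · simpa using hadd
    · simpa [add_comm] using hadd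
  · have h1 : Q.restrict (Set.Ioi 0) + Q.restrict (Set.Iic 0) = Q := by
      rw [← hcompl]; exact Measure.restrict_add_restrict_compl measurableSet_Ioi
    have h2 : Q (Set.Iic 0) • Q + Q (Set.Ioi 0) • Q = Q := by
      rw [← add_smul, add_comm, hadd, one_smul]
    simp only [cond_true, cond_false]
    rw [add_add_add_comm, h1, h2, ← two_smul ℝ≥0∞ Q, smul_smul,
      ENNReal.inv_mul_cancel (by simp) (by simp), one_smul]
  · have hnn : 0 ≤ᵐ[Q.restrict (Set.Ioi 0)] fun x : ℝ => x :=
      (ae_restrict_mem measurableSet_Ioi).mono fun x hx => le_of_lt hx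
    rw [setIntegral_pos_iff_support_of_nonneg_ae hnn hint.integrableOn]
    rw [pos_iff_ne_zero]
    intro h0
    have h1 : Q (Set.Ioi 0) = 0 := by
      refine measure_mono_null ?_ h0
      intro x hx
      exact ⟨ne_of_gt hx, hx⟩
    have h2 : ∀ᵐ x ∂Q, 0 ≤ -x := by
      rw [ae_iff]
      simp only [Left.nonneg_neg_iff, not_le]
      exact h1
    have h3 : (fun x : ℝ => -x) =ᵐ[Q] 0 :=
      (integral_eq_zero_iff_of_nonneg_ae h2 hint.neg).1 (by
        rw [integral_neg, hmean, neg_zero])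
    apply hvar
    have h4 : (id : ℝ → ℝ) =ᵐ[Q] 0 := h3.mono fun x hx => by simpa using hx
    rw [variance_congr h4, variance_zero]
  · show ∫ x, x ∂(Q (Set.Iic 0) • Q + Q.restrict (Set.Ioi 0)) = _
    rw [integral_add_measure (hint.smul_measure (by finiteness)) hint.restrict,
      integral_smul_measure, hmean, smul_zero, zero_add]
  · show ∫ x, x ∂(Q (Set.Ioi 0) • Q + Q.restrict (Set.Iic 0)) = _
    rw [integral_add_measure (hint.smul_measure (by finiteness)) hint.restrict,
      integral_smul_measure, hmean, smul_zero, zero_add]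
    have := integral_add_compl (μ := Q) (s := Set.Ioi 0) measurableSet_Ioi hint
    rw [hcompl, hmean] at this
    linarith

/-! ### Sums of independent random variables -/

/-- Chebyshev's inequality for a sum of functions of independent coordinates. -/
lemma measure_pi_sum_deviation_le {ι : Type*} [Fintype ι] {Ω : ι → Type*}
    [∀ i, MeasurableSpace (Ω i)] (μ : ∀ i, Measure (Ω i)) [∀ i, IsProbabilityMeasure (μ i)]
    (f : ∀ i, Ω i → ℝ) (hf : ∀ i, MemLp (f i) 2 (μ i)) {t : ℝ} (ht : 0 < t) :
    Measure.pi μ {ω | t ≤ |∑ i, f i (ω i) - ∑ i, ∫ x, f i x ∂μ i|} ≤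
      ENNReal.ofReal ((∑ i, Var[f i; μ i]) / t ^ 2) := by
  have hL : ∀ i, MemLp (fun ω : ∀ i, Ω i => f i (ω i)) 2 (Measure.pi μ) := fun i =>
    (hf i).comp_measurePreserving (measurePreserving_eval _ i)
  have h := meas_ge_le_variance_div_sq (memLp_finsetSum' Finset.univ fun i _ => hL i) ht
  rw [variance_sum_pi hf] at h
  simp only [Finset.sum_apply] at h
  rw [integral_finsetSum _ fun i _ => (hL i).integrable one_le_two] at h
  simpa only [integral_comp_eval (hf _).aestronglyMeasurable] using h

section RowSum

variable {p : ℕ} (ν : Fin p → Measure ℝ) [∀ j, IsProbabilityMeasure (ν j)] (T : Finset (Fin p))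

lemma memLp_rowSum (h : ∀ j, MemLp id 2 (ν j)) :
    MemLp (fun x : Fin p → ℝ => ∑ j ∈ T, x j) 2 (Measure.pi ν) :=
  memLp_finsetSum T fun j _ => (h j).comp_measurePreserving (measurePreserving_eval _ j)

lemma integral_rowSum (h : ∀ j, MemLp id 2 (ν j)) :
    ∫ x : Fin p → ℝ, ∑ j ∈ T, x j ∂Measure.pi ν = ∑ j ∈ T, ∫ x, x ∂ν j := by
  have hi : ∀ j, Integrable (fun x : Fin p → ℝ => x j) (Measure.pi ν) := fun j =>
    ((h j).comp_measurePreserving (measurePreserving_eval _ j)).integrable one_le_two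
  rw [integral_finsetSum _ fun j _ => hi j]
  exact Finset.sum_congr rfl fun j _ => integral_eval

lemma variance_rowSum (h : ∀ j, MemLp id 2 (ν j)) :
    Var[fun x : Fin p → ℝ => ∑ j ∈ T, x j; Measure.pi ν] = ∑ j ∈ T, Var[id; ν j] := by
  classical
  have h1 := variance_sum_pi (μ := ν) (X := fun j => if j ∈ T then id else 0) fun j => by
    split_ifs
    · exact h j
    · exact MemLp.zero
  have h2 : (∑ j, fun ω : Fin p → ℝ => (if j ∈ T then id else (0 : ℝ → ℝ)) (ω j)) =
      fun x : Fin p → ℝ => ∑ j ∈ T, x j := by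
    funext x
    rw [Finset.sum_apply, ← Finset.sum_filter_add_sum_filter_not Finset.univ (· ∈ T)]
    simp only [Finset.filter_univ_mem]
    rw [Finset.sum_congr rfl fun j hj => by rw [if_pos hj],
      Finset.sum_eq_zero (s := Finset.univ.filter (· ∉ T))]
    · simp
    · intro j hj
      rw [if_neg (by simpa using hj)]
      rfl
  rw [h2] at h1
  rw [h1, ← Finset.sum_filter_add_sum_filter_not Finset.univ (· ∈ T)]
  simp only [Finset.filter_univ_mem]
  rw [Finset.sum_congr rfl fun j hj => by rw [if_pos hj],
    Finset.sum_eq_zero (s := Finset.univ.filter (· ∉ T)), add_zero]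
  intro j hj
  rw [if_neg (by simpa using hj), variance_zero]

lemma hasSubgaussianMGF_rowSum {c : ℝ≥0} (h : ∀ j ∈ T, HasSubgaussianMGF id c (ν j)) :
    HasSubgaussianMGF (fun x : Fin p → ℝ => ∑ j ∈ T, x j) (T.card * c) (Measure.pi ν) := by
  have h1 : iIndepFun (fun (j : Fin p) (x : Fin p → ℝ) => x j) (Measure.pi ν) :=
    iIndepFun_pi (X := fun _ => id) fun _ => aemeasurable_id
  have h2 := HasSubgaussianMGF.sum_of_iIndepFun (c := fun _ => c) (s := T) h1 fun j hj => by
    refine HasSubgaussianMGF.of_map (X := id) (Y := fun x : Fin p → ℝ => x j)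
      (measurable_pi_apply j).aemeasurable ?_
    have hm : (Measure.pi ν).map (fun x => x j) = ν j := (measurePreserving_eval ν j).map_eq
    rw [hm]
    exact h j hj
  simpa using h2

end RowSum

/-- The fourth moment of a sub-Gaussian random variable. -/
lemma integral_pow_four_le {Ω : Type*} [MeasurableSpace Ω] {P : Measure Ω} {X : Ω → ℝ}
    {c : ℝ≥0} {κ : ℕ} (hκ : 0 < κ) (h : HasSubgaussianMGF X (κ * c) P) :
    ∫ ω, X ω ^ 4 ∂P ≤ 48 * Real.exp (c / 2) * κ ^ 2 := by
  have hκ' : (0 : ℝ) < κ := by exact_mod_cast hκ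
  -- At this scale the moment generating function is at most `exp (c / 2)`, free of `κ`; the fourth
  -- Taylor term `(t y)^4 / 4!` of `exp |t y|` then bounds `y ^ 4`.
  set t : ℝ := (√κ)⁻¹ with ht
  have htp : 0 < t := by positivity
  have ht2 : t ^ 2 = (κ : ℝ)⁻¹ := by rw [ht, inv_pow, Real.sq_sqrt hκ'.le]
  have hpt : ∀ y : ℝ, y ^ 4 ≤ 24 * κ ^ 2 * (Real.exp (t * y) + Real.exp (-t * y)) := by
    intro y
    have h1 := Real.pow_div_factorial_le_exp _ (abs_nonneg (t * y)) 4
    have h2 : |t * y| ^ 4 = y ^ 4 / κ ^ 2 := by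
      rw [Even.pow_abs (by decide), mul_pow, show t ^ 4 = (t ^ 2) ^ 2 by ring, ht2]
      field_simp
    have h3 := Real.exp_abs_le (t * y)
    rw [h2, show ((Nat.factorial 4 : ℕ) : ℝ) = 24 by norm_num [Nat.factorial]] at h1
    rw [← neg_mul] at h3
    have h4 := h1.trans h3
    rw [div_div, div_le_iff₀ (by positivity)] at h4
    linarith
  have hm : ∀ s : ℝ, s ^ 2 = (κ : ℝ)⁻¹ → ∫ ω, Real.exp (s * X ω) ∂P ≤ Real.exp (c / 2) := by
    intro s hs
    refine (h.mgf_le s).trans_eq ?_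
    congr 1
    rw [hs]
    push_cast
    field_simp
  have hi := (h.integrable_exp_mul t).add (h.integrable_exp_mul (-t))
  calc ∫ ω, X ω ^ 4 ∂P
      ≤ ∫ ω, 24 * κ ^ 2 * (Real.exp (t * X ω) + Real.exp (-t * X ω)) ∂P :=
        integral_mono_of_nonneg (ae_of_all _ fun ω => by positivity) (hi.const_mul _)
          (ae_of_all _ fun ω => hpt _)
    _ = 24 * κ ^ 2 * (∫ ω, Real.exp (t * X ω) ∂P + ∫ ω, Real.exp (-t * X ω) ∂P) := by
        rw [integral_const_mul, integral_add (h.integrable_exp_mul t) (h.integrable_exp_mul (-t))]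
    _ ≤ 24 * κ ^ 2 * (Real.exp (c / 2) + Real.exp (c / 2)) := by
        gcongr
        · exact hm _ ht2
        · exact hm _ (by rw [neg_sq, ht2])
    _ = _ := by ring

/-! ### The restricted isometry property and sums over blocks -/

/-- Only the upper isometry bound is used, at the single unit vector `1_T / √k`. -/
lemma RIP.sum_sq_le {n p k : ℕ} {θ : ℝ} (hn : 0 < n) (Z : Fin n → Fin p → ℝ)
    (T : Finset (Fin p)) (hT : T.card = k) (hk : 0 < k)
    (h : RIP k θ (Matrix.of fun i j => Z i j / √(n : ℝ))) :
    ∑ i, (∑ j ∈ T, Z i j) ^ 2 ≤ n * k * (1 + θ) := by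
  classical
  have hk' : (0 : ℝ) < k := by exact_mod_cast hk
  have hn' : (0 : ℝ) < n := by exact_mod_cast hn
  let u : EuclideanSpace ℝ (Fin p) := WithLp.toLp 2 fun j => if j ∈ T then (√(k : ℝ))⁻¹ else 0
  have hu : ‖u‖ = 1 := by
    rw [EuclideanSpace.norm_eq, Real.sqrt_eq_one]
    simp only [u, Real.norm_eq_abs, sq_abs, ite_pow, inv_pow, Real.sq_sqrt hk'.le]
    simp [hT, hk'.ne']
  have hs : {j | u j ≠ 0}.ncard ≤ k := by
    rw [← hT, ← Set.ncard_coe_finset]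
    refine Set.ncard_le_ncard (fun j hj => ?_) (Finset.finite_toSet T)
    by_contra hjT
    exact hj (if_neg hjT)
  have h2 := (h u hu hs).2
  have hval : ‖WithLp.toLp 2 ((Matrix.of fun i j => Z i j / √(n : ℝ)).mulVec u.ofLp)‖ ^ 2 =
      (∑ i, (∑ j ∈ T, Z i j) ^ 2) / (n * k) := by
    rw [EuclideanSpace.norm_sq_eq, Finset.sum_div]
    refine Finset.sum_congr rfl fun i _ => ?_
    have : (Matrix.of fun i j => Z i j / √(n : ℝ)).mulVec u.ofLp i =
        (∑ j ∈ T, Z i j) / (√(n : ℝ) * √(k : ℝ)) := by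
      simp only [Matrix.mulVec, dotProduct, Matrix.of_apply, u, mul_ite, mul_zero,
        Finset.sum_ite_mem, Finset.univ_inter, Finset.sum_div]
      refine Finset.sum_congr rfl fun j _ => ?_
      field_simp
    rw [Real.norm_eq_abs, sq_abs]
    change (Matrix.of fun i j => Z i j / √(n : ℝ)).mulVec u.ofLp i ^ 2 = _
    rw [this, div_pow, mul_pow, Real.sq_sqrt hn'.le,
      Real.sq_sqrt hk'.le]
  rw [hval, div_le_iff₀ (by positivity)] at h2
  linarith

/-- If the columns in `T` carry sub-Gaussian noise except for a shift of total size `M` on the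
rows in `T`, then the squared row sums over `T` exceed their typical value. -/
lemma measure_sum_sq_le {n : ℕ} (T : Finset (Fin (n + 1))) {κ : ℕ} (hT : T.card = κ) (hκ : 0 < κ)
    (Q : Measure ℝ) {c : ℝ≥0} (hQ : HasSubgaussianMGF id c Q) (hQ0 : ∫ x, x ∂Q = 0)
    (hQ1 : Var[id; Q] = 1)
    (ν : Fin n → Fin (n + 1) → Measure ℝ) [∀ i j, IsProbabilityMeasure (ν i j)]
    (hν : ∀ i j, i.castSucc ∉ T → ν i j = Q)
    (hL : ∀ i j, MemLp id 2 (ν i j)) (hvar : ∀ i j, Var[id; ν i j] ≤ 2)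
    {M t : ℝ} (hM : 0 < M) (ht : 0 < t)
    (hmean : M ≤ ∑ i with i.castSucc ∈ T, ∑ j ∈ T, ∫ x, x ∂ν i j) :
    (Measure.pi fun i => Measure.pi (ν i))
      {Z | ∑ i, (∑ j ∈ T, Z i j) ^ 2 ≤ (n - κ) * κ - t + M ^ 2 / (4 * κ)} ≤
      ENNReal.ofReal (n * (48 * Real.exp (c / 2) * κ ^ 2) / t ^ 2) +
        ENNReal.ofReal (8 * κ ^ 2 / M ^ 2) := by
  classical
  have hκ' : (0 : ℝ) < κ := by exact_mod_cast hκ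
  -- The last vertex has no row, so `S` may have one element fewer than `T`; only `S.card ≤ κ` is
  -- needed.
  set S : Finset (Fin n) := Finset.univ.filter fun i => i.castSucc ∈ T with hS
  have hScard : S.card ≤ κ := by
    rw [← hT, ← Finset.card_map Fin.castSuccEmb]
    refine Finset.card_le_card fun a ha => ?_
    obtain ⟨i, hi, rfl⟩ := Finset.mem_map.1 ha
    exact (Finset.mem_filter.1 hi).2
  let R : (Fin (n + 1) → ℝ) → ℝ := fun x => ∑ j ∈ T, x j
  have hSn : ∀ i ∉ S, ∀ j, ν i j = Q := fun i hi j => hν i j (by simpa [hS] using hi)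
  have hRL : ∀ i, MemLp R 2 (Measure.pi (ν i)) := fun i => memLp_rowSum _ _ (hL i)
  have hsub : ∀ i ∉ S, HasSubgaussianMGF R (κ * c) (Measure.pi (ν i)) := fun i hi => by
    rw [← hT]
    exact hasSubgaussianMGF_rowSum _ _ fun j _ => by rw [hSn i hi j]; exact hQ
  have hsqL : ∀ i ∉ S, MemLp (fun x => R x ^ 2) 2 (Measure.pi (ν i)) := fun i hi => by
    have h4 := ((hsub i hi).memLp 4)
    have h2 := h4.norm_rpow_div 2
    have h3 : ((4 : ℝ≥0) : ℝ≥0∞) / 2 = 2 := by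
      refine ((ENNReal.eq_div_iff (by simp) (by simp)).2 ?_).symm
      norm_num
    rw [h3] at h2
    simpa using h2
  have hsq : ∀ i ∉ S, ∫ x, R x ^ 2 ∂Measure.pi (ν i) = κ := fun i hi => by
    have h0 : ∫ x, R x ∂Measure.pi (ν i) = 0 := by
      rw [integral_rowSum _ _ (hL i)]
      simp [hSn i hi, hQ0]
    have h1 := variance_rowSum (ν i) T (hL i)
    rw [variance_of_integral_eq_zero (hRL i).aemeasurable h0] at h1
    simp only [hSn i hi, hQ1, Finset.sum_const, hT, nsmul_eq_mul, mul_one] at h1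
    simpa only [hSn i hi] using h1
  -- Rows outside `S` enter through squares, controlled by fourth moments of `Q`. Rows in `S` enter
  -- linearly through `g`, so two moments of the shifted laws suffice.
  let f : Fin n → (Fin (n + 1) → ℝ) → ℝ := fun i => if i ∈ S then 0 else fun x => R x ^ 2
  let g : Fin n → (Fin (n + 1) → ℝ) → ℝ := fun i => if i ∈ S then R else 0
  have hfL : ∀ i, MemLp (f i) 2 (Measure.pi (ν i)) := fun i => by
    by_cases hi : i ∈ S
    · simp only [f, if_pos hi]; exact MemLp.zero
    · simp only [f, if_neg hi]; exact hsqL i hi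
  have hgL : ∀ i, MemLp (g i) 2 (Measure.pi (ν i)) := fun i => by
    by_cases hi : i ∈ S
    · simp only [g, if_pos hi]; exact hRL i
    · simp only [g, if_neg hi]; exact MemLp.zero
  have hfvar : ∀ i, Var[f i; Measure.pi (ν i)] ≤ 48 * Real.exp (c / 2) * κ ^ 2 := fun i => by
    by_cases hi : i ∈ S
    · simp only [f, if_pos hi, variance_zero]; positivity
    · simp only [f, if_neg hi]
      refine (variance_le_expectation_sq (hsqL i hi).aestronglyMeasurable).trans ?_
      refine le_trans (le_of_eq ?_) (integral_pow_four_le hκ (hsub i hi))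
      refine integral_congr_ae (ae_of_all _ fun x => ?_)
      simp only [Pi.pow_apply]
      ring
  have hgvar : ∀ i, Var[g i; Measure.pi (ν i)] ≤ if i ∈ S then 2 * (κ : ℝ) else 0 := fun i => by
    by_cases hi : i ∈ S
    · simp only [g, if_pos hi]
      refine (variance_rowSum (ν i) T (hL i)).trans_le
        ((Finset.sum_le_sum fun j _ => hvar i j).trans_eq ?_)
      simp [hT, mul_comm]
    · simp only [g, if_neg hi, variance_zero]; exact le_rfl
  have hfmean : ((n : ℝ) - κ) * κ ≤ ∑ i, ∫ x, f i x ∂Measure.pi (ν i) := by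
    have h1 : ∀ i, ∫ x, f i x ∂Measure.pi (ν i) = (κ : ℝ) - if i ∈ S then (κ : ℝ) else 0 := by
      intro i
      by_cases hi : i ∈ S
      · simp [f, hi]
      · simp [f, hi, hsq i hi]
    rw [Finset.sum_congr rfl fun i _ => h1 i, Finset.sum_sub_distrib]
    simp only [Finset.sum_const, Finset.card_univ, Fintype.card_fin, nsmul_eq_mul,
      Finset.sum_ite_mem, Finset.univ_inter]
    have : (S.card : ℝ) ≤ κ := by exact_mod_cast hScard
    nlinarith
  have hgmean : M ≤ ∑ i, ∫ x, g i x ∂Measure.pi (ν i) := by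
    refine hmean.trans_eq ?_
    rw [← Finset.sum_filter_add_sum_filter_not Finset.univ (· ∈ S)]
    simp only [Finset.filter_univ_mem]
    rw [Finset.sum_eq_zero (s := Finset.univ.filter (· ∉ S)), add_zero]
    · refine Finset.sum_congr rfl fun i hi => ?_
      simp only [g, if_pos hi]
      exact (integral_rowSum (ν i) T (hL i)).symm
    · intro i hi
      simp [g, (Finset.mem_filter.1 hi).2]
  have hA := measure_pi_sum_deviation_le (fun i => Measure.pi (ν i)) f hfL ht
  have hB := measure_pi_sum_deviation_le (fun i => Measure.pi (ν i)) g hgL (half_pos hM)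
  refine (measure_mono (t := _ ∪ _) ?_).trans ((measure_union_le _ _).trans (add_le_add
    (hA.trans (ENNReal.ofReal_le_ofReal ?_)) (hB.trans (ENNReal.ofReal_le_ofReal ?_))))
  · intro Z hZ
    by_contra hcon
    simp only [Set.mem_union, Set.mem_ofPred_eq, not_or, not_le, abs_lt] at hcon hZ
    obtain ⟨⟨h1, -⟩, ⟨h2, -⟩⟩ := hcon
    have h3 : ∑ i, (∑ j ∈ T, Z i j) ^ 2 = ∑ i, f i (Z i) + ∑ i ∈ S, R (Z i) ^ 2 := by
      have : ∀ i, (∑ j ∈ T, Z i j) ^ 2 = f i (Z i) + if i ∈ S then R (Z i) ^ 2 else 0 := by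
        intro i
        by_cases hi : i ∈ S <;> simp [f, hi, R]
      rw [Finset.sum_congr rfl fun i _ => this i, Finset.sum_add_distrib]
      simp
    have h4 : ∑ i, g i (Z i) = ∑ i ∈ S, R (Z i) := by
      have : ∀ i, g i (Z i) = if i ∈ S then R (Z i) else 0 := by
        intro i
        by_cases hi : i ∈ S <;> simp [g, hi]
      rw [Finset.sum_congr rfl fun i _ => this i]
      simp
    -- Cauchy–Schwarz turns a linear sum above `M / 2` into squares of total at least `M ^ 2 / (4 *
    -- κ)`.
    have h5 : (∑ i ∈ S, R (Z i)) ^ 2 ≤ S.card * ∑ i ∈ S, R (Z i) ^ 2 := sq_sum_le_card_mul_sum_sq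
    have h6 : M / 2 < ∑ i ∈ S, R (Z i) := by rw [← h4]; linarith
    have h7 : M ^ 2 / (4 * κ) ≤ ∑ i ∈ S, R (Z i) ^ 2 := by
      rw [div_le_iff₀ (by positivity)]
      have h8 : (S.card : ℝ) ≤ κ := by exact_mod_cast hScard
      have h9 : 0 ≤ ∑ i ∈ S, R (Z i) ^ 2 := Finset.sum_nonneg fun i _ => sq_nonneg _
      nlinarith [mul_le_mul_of_nonneg_right h8 h9]
    rw [h3] at hZ
    linarith
  · gcongr
    refine (Finset.sum_le_sum fun i _ => hfvar i).trans_eq ?_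
    simp
  · have h1 : ∑ i, Var[g i; Measure.pi (ν i)] ≤ 2 * κ ^ 2 := by
      refine (Finset.sum_le_sum fun i _ => hgvar i).trans ?_
      simp only [Finset.sum_ite_mem, Finset.univ_inter, Finset.sum_const, nsmul_eq_mul]
      have h8 : (S.card : ℝ) ≤ κ := by exact_mod_cast hScard
      nlinarith
    rw [div_le_div_iff₀ (by positivity) (by positivity)]
    nlinarith [sq_nonneg M]

/-! ### Matrices built from graphs -/

open Classical in
/-- The law of a matrix whose entry at a position above the diagonal has law `ρ b`, where `b` is
the indicator of the corresponding edge of `G`, and whose other entries have law `Q`. -/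
def graphLaw {n : ℕ} (ρ : Bool → Measure ℝ) (Q : Measure ℝ) (G : SimpleGraph (Fin (n + 1))) :
    Measure (Fin n → Fin (n + 1) → ℝ) :=
  Measure.pi fun i => Measure.pi fun j =>
    if i.castSucc < j then ρ (decide (G.Adj i.castSucc j)) else Q

section GraphLaw

variable {n : ℕ} (ρ : Bool → Measure ℝ) [∀ b, IsProbabilityMeasure (ρ b)] (Q : Measure ℝ)
  [IsProbabilityMeasure Q]

lemma isProbabilityMeasure_ite (P : Prop) [Decidable P] (μ ν : Measure ℝ)
    [IsProbabilityMeasure μ] [IsProbabilityMeasure ν] :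
    IsProbabilityMeasure (if P then μ else ν) := by
  split_ifs <;> infer_instance

instance (G : SimpleGraph (Fin (n + 1))) : IsProbabilityMeasure (graphLaw ρ Q G) := by
  have := fun (i : Fin n) (j : Fin (n + 1)) (b : Bool) =>
    isProbabilityMeasure_ite (i.castSucc < j) (ρ b) Q
  unfold graphLaw
  infer_instance

lemma inv_two_smul_add_self (μ : Measure ℝ) : (2⁻¹ : ℝ≥0∞) • (μ + μ) = μ := by
  rw [← two_smul ℝ≥0∞ μ, smul_smul, ENNReal.inv_mul_cancel (by simp) (by simp), one_smul]

lemma lintegral_graphLaw (hρ : (2⁻¹ : ℝ≥0∞) • (ρ true + ρ false) = Q)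
    {B : Set (Fin n → Fin (n + 1) → ℝ)} (hB : MeasurableSet B) :
    ∫⁻ G, graphLaw ρ Q G B ∂erdosRenyi (n + 1) =
      (Measure.pi fun _ => Measure.pi fun _ => Q) B := by
  have := fun (i : Fin n) (j : Fin (n + 1)) (b : Bool) =>
    isProbabilityMeasure_ite (i.castSucc < j) (ρ b) Q
  refine lintegral_pi_edges (fun i j b => if i.castSucc < j then ρ b else Q) (fun _ _ => Q)
    (fun i j => ?_) (fun i j hij => by simp [hij]) hB
  by_cases hij : i.castSucc < j
  · simp only [if_pos hij, hρ]
  · simp only [if_neg hij, inv_two_smul_add_self]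

lemma plant_adj {κ m : ℕ} (H : SimpleGraph (Fin κ)) (e : Fin κ ↪ Fin m) (G : SimpleGraph (Fin m))
    {a b : Fin m} (hab : a ≠ b) : (plant H e G).Adj a b ↔
      if a ∈ Finset.univ.map e ∧ b ∈ Finset.univ.map e then (H.map e).Adj a b else G.Adj a b := by
  have htop : ((⊤ : SimpleGraph (Fin κ)).map e).Adj a b ↔
      a ∈ Finset.univ.map e ∧ b ∈ Finset.univ.map e := by
    simp only [SimpleGraph.map_adj, SimpleGraph.top_adj, Finset.mem_map, Finset.mem_univ, true_and]
    constructor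
    · rintro ⟨u, v, -, rfl, rfl⟩
      exact ⟨⟨u, rfl⟩, ⟨v, rfl⟩⟩
    · rintro ⟨⟨u, rfl⟩, ⟨v, rfl⟩⟩
      exact ⟨u, v, fun h => hab (by rw [h]), rfl, rfl⟩
  have hmono : (H.map e).Adj a b → ((⊤ : SimpleGraph (Fin κ)).map e).Adj a b := by
    rintro ⟨-, h⟩
    exact ⟨hab, by obtain ⟨u, v, h, h1, h2⟩ := h; exact ⟨u, v, h.ne, h1, h2⟩⟩
  simp only [plant, SimpleGraph.sup_adj, SimpleGraph.sdiff_adj]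
  rw [htop] at hmono ⊢
  split_ifs with h <;> tauto

open Classical in
/-- The entry laws of the matrix built from a planted graph. -/
def plantedEntry {κ : ℕ} (H : SimpleGraph (Fin κ)) (e : Fin κ ↪ Fin (n + 1)) (i : Fin n)
    (j : Fin (n + 1)) : Measure ℝ :=
  if i.castSucc < j ∧ i.castSucc ∈ Finset.univ.map e ∧ j ∈ Finset.univ.map e then
    ρ (decide ((H.map e).Adj i.castSucc j)) else Q

instance {κ : ℕ} (H : SimpleGraph (Fin κ)) (e : Fin κ ↪ Fin (n + 1)) (i : Fin n)
    (j : Fin (n + 1)) : IsProbabilityMeasure (plantedEntry ρ Q H e i j) :=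
  isProbabilityMeasure_ite _ _ _

/-- Inside the planted block the edge bits are fixed by `H` and `e`; elsewhere they remain fair
coins, which average `ρ` back to `Q`. Independence of the entries therefore survives. -/
lemma lintegral_graphLaw_plant (hρ : (2⁻¹ : ℝ≥0∞) • (ρ true + ρ false) = Q)
    {κ : ℕ} (H : SimpleGraph (Fin κ)) (e : Fin κ ↪ Fin (n + 1))
    {B : Set (Fin n → Fin (n + 1) → ℝ)} (hB : MeasurableSet B) :
    ∫⁻ G, graphLaw ρ Q (plant H e G) B ∂erdosRenyi (n + 1) =
      (Measure.pi fun i => Measure.pi fun j => plantedEntry ρ Q H e i j) B := by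
  classical
  let r : Fin n → Fin (n + 1) → Bool → Measure ℝ := fun i j b =>
    if i.castSucc < j then
      ρ (if i.castSucc ∈ Finset.univ.map e ∧ j ∈ Finset.univ.map e then
        decide ((H.map e).Adj i.castSucc j) else b) else Q
  have : ∀ i j b, IsProbabilityMeasure (r i j b) := fun i j b => isProbabilityMeasure_ite _ _ _
  rw [← lintegral_pi_edges r (plantedEntry ρ Q H e) (fun i j => ?_)
    (fun i j hij => by simp [r, hij]) hB]
  · refine lintegral_congr fun G => ?_
    unfold graphLaw
    congr 3
    funext i
    congr 1
    funext j
    by_cases hij : i.castSucc < j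
    · simp only [r, if_pos hij]
      congr 1
      rw [Bool.eq_iff_iff, decide_eq_true_iff, plant_adj H e G hij.ne]
      split_ifs <;> simp
    · simp only [r, if_neg hij]
  · unfold plantedEntry
    by_cases hij : i.castSucc < j
    · by_cases hT : i.castSucc ∈ Finset.univ.map e ∧ j ∈ Finset.univ.map e
      · simp only [r, if_pos hij, if_pos hT, inv_two_smul_add_self, if_pos (And.intro hij hT)]
      · rw [if_neg fun h => hT h.2]
        simp only [r, if_pos hij, if_neg hT, hρ]
    · rw [if_neg fun h => hij h.1]
      simp only [r, if_neg hij, inv_two_smul_add_self]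

end GraphLaw

/-! ### The size of the planted shift -/

/-- The missing row of the last vertex costs nothing, since no vertex lies above it; symmetry of `g`
gives the factor one half. -/
lemma sum_castSucc_lt {n : ℕ} (T : Finset (Fin (n + 1))) (g : Fin (n + 1) → Fin (n + 1) → ℝ)
    (hg : ∀ a b, g a b = g b a) :
    ∑ i : Fin n with i.castSucc ∈ T, ∑ j ∈ T, (if i.castSucc < j then g i.castSucc j else 0) =
      2⁻¹ * ∑ a ∈ T, ∑ b ∈ T, if a ≠ b then g a b else 0 := by
  have h1 : ∑ i : Fin n with i.castSucc ∈ T, ∑ j ∈ T,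
      (if i.castSucc < j then g i.castSucc j else 0) =
      ∑ a ∈ T, ∑ b ∈ T, if a < b then g a b else 0 := by
    rw [Finset.sum_filter, ← Finset.univ_inter T, ← Finset.sum_ite_mem, Fin.sum_univ_castSucc]
    simp only [Finset.univ_inter]
    rw [left_eq_add]
    simp [Fin.not_lt.2 (Fin.le_last _)]
  have h2 : ∑ a ∈ T, ∑ b ∈ T, (if b < a then g a b else 0) =
      ∑ a ∈ T, ∑ b ∈ T, if a < b then g a b else 0 := by
    rw [Finset.sum_comm]
    simp only [hg]
  have h3 : ∀ a b, (if a ≠ b then g a b else 0) =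
      (if a < b then g a b else 0) + if b < a then g a b else 0 := by
    intro a b
    rcases lt_trichotomy a b with h | rfl | h
    · simp [h, h.ne, h.not_gt]
    · simp
    · simp [h, h.ne', h.not_gt]
  simp only [h3, Finset.sum_add_distrib]
  rw [h1, h2]
  ring

open Classical in
lemma sum_sign_map {κ m : ℕ} (H : SimpleGraph (Fin κ)) (e : Fin κ ↪ Fin m) :
    ∑ a ∈ Finset.univ.map e, ∑ b ∈ Finset.univ.map e,
      (if a ≠ b then (if (H.map e).Adj a b then 1 else -1 : ℝ) else 0) =
      4 * (H.edgeSet.ncard : ℝ) - κ * (κ - 1) := by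
  have h1 : ∀ a b : Fin κ, (if e a ≠ e b then (if (H.map e).Adj (e a) (e b) then 1 else -1 : ℝ)
      else 0) = 2 * (if H.Adj a b then 1 else 0) - (1 - if a = b then 1 else 0) := by
    intro a b
    by_cases hab : a = b
    · simp [hab]
    · by_cases h : H.Adj a b
      · simp [hab, h]; norm_num
      · simp [hab, h]
  have h2 : ∑ a, ∑ b, (if H.Adj a b then 1 else 0 : ℝ) = 2 * (H.edgeSet.ncard : ℝ) := by
    have h3 := H.sum_degrees_eq_twice_card_edges
    rw [← Set.ncard_coe_finset, SimpleGraph.coe_edgeFinset] at h3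
    have h4 : ((∑ v, H.degree v : ℕ) : ℝ) = 2 * (H.edgeSet.ncard : ℝ) := by
      rw [h3]; push_cast; rfl
    rw [← h4]
    push_cast
    refine Finset.sum_congr rfl fun a _ => ?_
    rw [← SimpleGraph.card_neighborFinset_eq_degree, SimpleGraph.neighborFinset_eq_filter]
    simp
  simp only [Finset.sum_map, h1, Finset.sum_sub_distrib, ← Finset.mul_sum, h2]
  simp
  ring

/-- Edges count `c` and non-edges `-c`. Density `1/2 + ε` makes the signed count over ordered pairs
at least `2 ε κ (κ - 1)`, and half of it lies above the diagonal. -/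
lemma le_sum_integral_plantedEntry {n : ℕ} {ρ : Bool → Measure ℝ} {Q : Measure ℝ}
    (hQ0 : ∫ x, x ∂Q = 0) {c : ℝ} (hc : 0 < c) (h1 : ∫ x, x ∂ρ true = c)
    (h0 : ∫ x, x ∂ρ false = -c) {κ : ℕ} {ε : ℝ} {H : SimpleGraph (Fin κ)}
    (hH : H ∈ denseGraphs κ ε) (e : Fin κ ↪ Fin (n + 1)) :
    c * ε * (κ * (κ - 1)) ≤ ∑ i : Fin n with i.castSucc ∈ Finset.univ.map e,
      ∑ j ∈ Finset.univ.map e, ∫ x, x ∂plantedEntry ρ Q H e i j := by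
  classical
  have key : ∑ i : Fin n with i.castSucc ∈ Finset.univ.map e,
      ∑ j ∈ Finset.univ.map e, ∫ x, x ∂plantedEntry ρ Q H e i j =
      ∑ i : Fin n with i.castSucc ∈ Finset.univ.map e, ∑ j ∈ Finset.univ.map e,
        if i.castSucc < j then (c * if (H.map e).Adj i.castSucc j then 1 else -1) else 0 := by
    refine Finset.sum_congr rfl fun i hi => Finset.sum_congr rfl fun j hj => ?_
    have hi := (Finset.mem_filter.1 hi).2
    unfold plantedEntry
    by_cases hij : i.castSucc < j
    · rw [if_pos ⟨hij, hi, hj⟩, if_pos hij]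
      by_cases h : (H.map e).Adj i.castSucc j
      · simp [h, h1]
      · simp [h, h0]
    · rw [if_neg fun h => hij h.1, if_neg hij, hQ0]
  rw [key, sum_castSucc_lt (Finset.univ.map e)
    (fun a b => c * if (H.map e).Adj a b then 1 else -1) fun a b =>
    congrArg (c * ·) (if_congr (SimpleGraph.adj_comm _ _ _) rfl rfl)]
  have h2 := sum_sign_map H e
  have h3 : ∀ a b, (if a ≠ b then (c * if (H.map e).Adj a b then 1 else -1) else 0) =
      c * if a ≠ b then (if (H.map e).Adj a b then 1 else -1 : ℝ) else 0 := by
    intro a b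
    by_cases hab : a = b <;> simp [hab]
  simp only [h3, ← Finset.mul_sum, h2]
  have h4 : (1 / 2 + ε) * ((κ : ℝ) * ((κ : ℝ) - 1) / 2) ≤ (H.edgeSet.ncard : ℝ) := hH
  nlinarith

/-! ### Second moments of the two entry laws, by domination by `2 • Q` -/

section Moments

variable {ρ : Bool → Measure ℝ} {Q : Measure ℝ}

lemma le_two_smul_of_mixture (hρ : (2⁻¹ : ℝ≥0∞) • (ρ true + ρ false) = Q) (b : Bool) :
    ρ b ≤ (2 : ℝ≥0∞) • Q := by
  rw [← hρ, smul_smul, ENNReal.mul_inv_cancel (by simp) (by simp), one_smul]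
  cases b
  · exact Measure.le_add_left le_rfl
  · exact Measure.le_add_right le_rfl

lemma memLp_of_mixture (hρ : (2⁻¹ : ℝ≥0∞) • (ρ true + ρ false) = Q) (hL : MemLp id 2 Q)
    (b : Bool) : MemLp id 2 (ρ b) :=
  (hL.smul_measure (c := 2) (by simp)).mono_measure (le_two_smul_of_mixture hρ b)

lemma variance_le_of_mixture [∀ b, IsProbabilityMeasure (ρ b)] [IsProbabilityMeasure Q]
    (hρ : (2⁻¹ : ℝ≥0∞) • (ρ true + ρ false) = Q)
    (hL : MemLp id 2 Q) (hQ0 : ∫ x, x ∂Q = 0) (hQ1 : Var[id; Q] = 1) (b : Bool) :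
    Var[id; ρ b] ≤ 2 := by
  have hsq : ∫ x, x ^ 2 ∂Q = 1 := by
    rw [← hQ1, variance_of_integral_eq_zero aemeasurable_id hQ0]
    rfl
  refine (variance_le_expectation_sq aestronglyMeasurable_id).trans ?_
  calc ∫ x, ((id : ℝ → ℝ) ^ 2) x ∂ρ b ≤ ∫ x, ((id : ℝ → ℝ) ^ 2) x ∂((2 : ℝ≥0∞) • Q) :=
        integral_mono_measure (le_two_smul_of_mixture hρ b)
          (ae_of_all _ fun x => by simpa using sq_nonneg x)
          ((hL.integrable_sq).smul_measure (by simp))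
    _ = 2 := by
        rw [integral_smul_measure]
        simp [hsq]

end Moments

/-- The matrix built from a planted dense graph rarely has the restricted isometry property. -/
lemma lintegral_graphLaw_plant_le {n : ℕ} (hn : 0 < n) {ρ : Bool → Measure ℝ}
    [∀ b, IsProbabilityMeasure (ρ b)] {Q : Measure ℝ} [IsProbabilityMeasure Q]
    {s : ℝ≥0} (hQ : HasSubgaussianMGF id s Q) (hQ0 : ∫ x, x ∂Q = 0) (hQ1 : Var[id; Q] = 1)
    (hρ : (2⁻¹ : ℝ≥0∞) • (ρ true + ρ false) = Q) {c : ℝ} (hc : 0 < c)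
    (h1 : ∫ x, x ∂ρ true = c) (h0 : ∫ x, x ∂ρ false = -c) {κ : ℕ} (hκ : 2 ≤ κ) {ε θ : ℝ}
    (hε : 0 < ε) {t : ℝ} (ht : 0 < t)
    (htκ : n * κ * (1 + θ) ≤ (n - κ) * κ - t + (c * ε * (κ * (κ - 1))) ^ 2 / (4 * κ))
    {H : SimpleGraph (Fin κ)} (hH : H ∈ denseGraphs κ ε) (e : Fin κ ↪ Fin (n + 1))
    {B : Set (Fin n → Fin (n + 1) → ℝ)} (hB : MeasurableSet B)
    (hrip : ∀ Z ∈ B, RIP κ θ (Matrix.of fun i j => Z i j / √(n : ℝ))) :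
    ∫⁻ G, graphLaw ρ Q (plant H e G) B ∂erdosRenyi (n + 1) ≤
      ENNReal.ofReal (n * (48 * Real.exp (s / 2) * κ ^ 2) / t ^ 2) +
        ENNReal.ofReal (8 * κ ^ 2 / (c * ε * (κ * (κ - 1))) ^ 2) := by
  have hL : MemLp id 2 Q := hQ.memLp 2
  have hT : (Finset.univ.map e).card = κ := by simp
  have hκ' : (2 : ℝ) ≤ κ := by exact_mod_cast hκ
  rw [lintegral_graphLaw_plant ρ Q hρ H e hB]
  refine (measure_mono fun Z hZ => ?_).trans
    (measure_sum_sq_le (Finset.univ.map e) hT (by omega) Q hQ hQ0 hQ1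
      (fun i j => plantedEntry ρ Q H e i j) (fun i j hi => ?_) (fun i j => ?_) (fun i j => ?_)
      (M := c * ε * (κ * (κ - 1))) (t := t) ?_ ht
      (le_sum_integral_plantedEntry hQ0 hc h1 h0 hH e))
  · exact ((hrip Z hZ).sum_sq_le hn Z _ hT (by omega)).trans htκ
  · exact if_neg fun h => hi h.2.1
  · unfold plantedEntry
    split_ifs
    · exact memLp_of_mixture hρ hL _
    · exact hL
  · unfold plantedEntry
    split_ifs
    · exact variance_le_of_mixture hρ hL hQ0 hQ1 _
    · rw [hQ1]; exact one_le_two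
  · have : (0 : ℝ) < κ - 1 := by linarith
    positivity

/-! ### From certifiers to tests on graphs -/

instance (r : ℕ) : IsProbabilityMeasure (coinLaw r) := by
  unfold coinLaw
  exact isProbabilityMeasure_uniformOn Set.finite_univ Set.univ_nonempty

lemma coinLaw_apply (r : ℕ) (q : (Fin r → Bool) → Prop) [DecidablePred q] :
    coinLaw r {ω | q ω} =
      ENNReal.ofReal ((Finset.univ.filter q).card / Fintype.card (Fin r → Bool)) := by
  have h : {ω | q ω} = ((Finset.univ.filter q : Finset (Fin r → Bool)) : Set (Fin r → Bool)) := by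
    simp
  rw [coinLaw, uniformOn_univ, h, Measure.count_apply_finset,
    ENNReal.ofReal_div_of_pos (by exact_mod_cast Fintype.card_pos), ENNReal.ofReal_natCast,
    ENNReal.ofReal_natCast]

lemma RandPolyMatrixTest.measurable_run {p : ℕ → ℕ} (ψ : RandPolyMatrixTest p) (n : ℕ) :
    Measurable fun x : (Fin n → Fin (p n) → ℝ) × (Fin (ψ.coins n) → Bool) =>
      ψ.run n (Matrix.of x.1) x.2 := by
  obtain ⟨c, hc⟩ := ψ.polyTime
  obtain ⟨-, -, C, -, hC⟩ := hc n
  simp only [hC]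
  refine (measurable_of_finite C).comp (measurable_pi_iff.2 ?_)
  rintro (q | q)
  · exact (measurable_pi_apply q.2).comp ((ψ.enc_measurable n).comp
      ((measurable_pi_apply q.1.2).comp ((measurable_pi_apply q.1.1).comp measurable_fst)))
  · exact (measurable_pi_apply q).comp measurable_snd

lemma measurable_scale (n p : ℕ) :
    Measurable fun (Z : Fin n → Fin p → ℝ) i j => Z i j / √(n : ℝ) := by
  fun_prop

/-- The output of a matrix test on the rescaled matrix `Z / √n`. -/
def RandPolyMatrixTest.scaledRun {p : ℕ → ℕ} (ψ : RandPolyMatrixTest p) (n : ℕ)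
    (x : (Fin n → Fin (p n) → ℝ) × (Fin (ψ.coins n) → Bool)) : Bool :=
  ψ.run n (Matrix.of fun i j => x.1 i j / √(n : ℝ)) x.2

lemma RandPolyMatrixTest.measurable_scaledRun {p : ℕ → ℕ} (ψ : RandPolyMatrixTest p) (n : ℕ) :
    Measurable (ψ.scaledRun n) :=
  (ψ.measurable_run n).comp (((measurable_scale n (p n)).comp measurable_fst).prodMk measurable_snd)

/-- Moving the factor `1 / √n` from the law into the test lets the reduction work with unscaled
entries. -/
lemma designLaw_prod_apply (Q : Measure ℝ) [IsProbabilityMeasure Q] {p : ℕ → ℕ}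
    (ψ : RandPolyMatrixTest p) (n : ℕ) (b : Bool) :
    ((designLaw Q n (p n)).prod (coinLaw (ψ.coins n))) {x | ψ.run n (Matrix.of x.1) x.2 = b} =
      ((Measure.pi fun _ => Measure.pi fun _ => Q).prod (coinLaw (ψ.coins n)))
        {x | ψ.scaledRun n x = b} := by
  have hs : Measurable fun z : ℝ => z / √(n : ℝ) := by fun_prop
  have : IsProbabilityMeasure (Q.map fun z => z / √(n : ℝ)) :=
    Measure.isProbabilityMeasure_map hs.aemeasurable
  have h : designLaw Q n (p n) = (Measure.pi fun _ => Measure.pi fun _ => Q).map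
      fun (Z : Fin n → Fin (p n) → ℝ) i j => Z i j / √(n : ℝ) := by
    have h1 : (Measure.pi fun _ : Fin (p n) => Q).map (fun z j => z j / √(n : ℝ)) =
        Measure.pi fun _ => Q.map fun z => z / √(n : ℝ) :=
      Measure.pi_map_pi (f := fun _ z => z / √(n : ℝ)) fun _ => hs.aemeasurable
    have hs' : Measurable fun (z : Fin (p n) → ℝ) j => z j / √(n : ℝ) := by fun_prop
    have : IsProbabilityMeasure ((Measure.pi fun _ : Fin (p n) => Q).map
        (fun z j => z j / √(n : ℝ))) := Measure.isProbabilityMeasure_map hs'.aemeasurable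
    rw [designLaw, ← h1]
    exact (Measure.pi_map_pi (f := fun _ (z : Fin (p n) → ℝ) j => z j / √(n : ℝ))
      fun _ => hs'.aemeasurable).symm
  rw [h]
  conv_lhs => rw [← Measure.map_id (μ := coinLaw (ψ.coins n))]
  rw [Measure.map_prod_map _ _ (measurable_scale n (p n)) measurable_id]
  exact Measure.map_apply ((measurable_scale n (p n)).prodMap measurable_id)
    (ψ.measurable_run n (MeasurableSet.singleton b))

/-! ### Separating the graph from the remaining randomness -/

section Seeds

variable {n : ℕ} (ρ : Bool → Measure ℝ) [∀ b, IsProbabilityMeasure (ρ b)] (Q : Measure ℝ)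
  [IsProbabilityMeasure Q]

/-- The matrix read off from a graph, given as a string of bits, and a family of candidate
entries. -/
def seedMatrix (x : Fin (n + 1) × Fin (n + 1) → Bool)
    (y : Fin n → Fin (n + 1) → Option Bool → ℝ) (i : Fin n) (j : Fin (n + 1)) : ℝ :=
  y i j (if i.castSucc < j then some (x (i.castSucc, j)) else none)

/-- The law of a triple of candidates for a matrix entry. -/
def candidateLaw (ρ : Bool → Measure ℝ) (Q : Measure ℝ) : Measure (Option Bool → ℝ) :=
  Measure.pi fun o => o.elim Q ρ

instance (o : Option Bool) : IsProbabilityMeasure (o.elim Q ρ) := by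
  cases o <;> simp only [Option.elim] <;> infer_instance

instance : IsProbabilityMeasure (candidateLaw ρ Q) := by
  unfold candidateLaw; infer_instance

/-- Each position reads exactly one of its candidates, chosen by the graph. The law of the
candidates does not depend on the graph, as `exists_seeds` requires. -/
lemma map_seedMatrix (G : SimpleGraph (Fin (n + 1))) :
    (Measure.pi fun _ => Measure.pi fun _ => candidateLaw ρ Q).map (seedMatrix (adjBits G)) =
      graphLaw ρ Q G := by
  let o : Fin n → Fin (n + 1) → Option Bool := fun i j =>
    if i.castSucc < j then some (adjBits G (i.castSucc, j)) else none
  have h1 : ∀ i j, (candidateLaw ρ Q).map (fun y => y (o i j)) = (o i j).elim Q ρ := fun i j =>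
    (measurePreserving_eval (fun o : Option Bool => o.elim Q ρ) (o i j)).map_eq
  have hP : ∀ i j, IsProbabilityMeasure ((candidateLaw ρ Q).map fun y => y (o i j)) := fun i j =>
    Measure.isProbabilityMeasure_map (measurable_pi_apply _).aemeasurable
  have hm : ∀ i, Measurable fun (y : Fin (n + 1) → Option Bool → ℝ) j => y j (o i j) := fun i =>
    measurable_pi_iff.2 fun j => (measurable_pi_apply _).comp (measurable_pi_apply j)
  have h2 : ∀ i, (Measure.pi fun _ : Fin (n + 1) => candidateLaw ρ Q).map
      (fun y j => y j (o i j)) = Measure.pi fun j => (o i j).elim Q ρ := fun i => by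
    refine (Measure.pi_map_pi (μ := fun _ : Fin (n + 1) => candidateLaw ρ Q)
      (f := fun j y => y (o i j)) fun j => (measurable_pi_apply _).aemeasurable).trans ?_
    simp only [h1]
  have hP2 : ∀ i, IsProbabilityMeasure ((Measure.pi fun _ : Fin (n + 1) => candidateLaw ρ Q).map
      fun y j => y j (o i j)) := fun i => Measure.isProbabilityMeasure_map (hm i).aemeasurable
  have h3 := Measure.pi_map_pi (μ := fun _ : Fin n => Measure.pi fun _ : Fin (n + 1) =>
    candidateLaw ρ Q) (f := fun i y j => y j (o i j)) fun i => (hm i).aemeasurable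
  refine h3.trans ?_
  simp only [h2]
  unfold graphLaw
  congr 1
  funext i
  congr 1
  funext j
  by_cases hij : i.castSucc < j
  · simp only [o, if_pos hij, Option.elim]
    rfl
  · simp only [o, if_neg hij, Option.elim]

lemma measurable_seedMatrix (x : Fin (n + 1) × Fin (n + 1) → Bool) :
    Measurable (seedMatrix (n := n) x) := by
  unfold seedMatrix
  fun_prop

lemma prod_map_seedMatrix_apply (G : SimpleGraph (Fin (n + 1))) {p : ℕ}
    {S : Set ((Fin n → Fin (n + 1) → ℝ) × (Fin p → Bool))} (hS : MeasurableSet S) :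
    ((Measure.pi fun _ => Measure.pi fun _ => candidateLaw ρ Q).prod (coinLaw p))
      {s | (seedMatrix (adjBits G) s.1, s.2) ∈ S} = ((graphLaw ρ Q G).prod (coinLaw p)) S := by
  rw [← map_seedMatrix]
  conv_rhs => rw [← Measure.map_id (μ := coinLaw p)]
  rw [Measure.map_prod_map _ _ (measurable_seedMatrix _) measurable_id,
    Measure.map_apply ((measurable_seedMatrix _).prodMap measurable_id) hS]
  rfl

end Seeds

/-- The number of coins used to select a seed. -/
def seedCoins (n : ℕ) : ℕ := 4 * (Nat.log 2 (n + 1) + 1)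

lemma two_pow_seedCoins_le (n : ℕ) : 2 ^ seedCoins n ≤ (2 * (n + 1)) ^ 4 := by
  rw [seedCoins, mul_comm, pow_mul]
  refine Nat.pow_le_pow_left ?_ 4
  rw [pow_succ, mul_comm]
  exact Nat.mul_le_mul_left 2 (Nat.pow_log_le_self 2 (by omega))

lemma le_two_pow_seedCoins (n : ℕ) : (n + 1) ^ 4 ≤ 2 ^ seedCoins n := by
  rw [seedCoins, mul_comm, pow_mul]
  exact Nat.pow_le_pow_left (Nat.lt_pow_succ_log_self one_lt_two _).le 4

lemma seedCoins_le (n : ℕ) : seedCoins n ≤ 4 * (n + 2) := by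
  have := Nat.log_le_self 2 (n + 1)
  unfold seedCoins
  omega

/-- At least `(n + 1) ^ 4` seeds at accuracy `1 / √(n + 1)` give a Hoeffding exponent of order `(n +
1) ^ 3`, while the union bound costs at most `2 ^ ((n + 1) ^ 2)`. -/
lemma seeds_suffice (n : ℕ) : 2 * (Fintype.card (SimpleGraph (Fin (n + 1))) : ℝ) *
    Real.exp (-(2 * (Fintype.card (Fin (seedCoins n) → Bool) : ℕ) *
      (1 / √((n : ℝ) + 1)) ^ 2)) < 1 := by
  have hN : (0 : ℝ) < (n : ℝ) + 1 := by positivity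
  have hN1 : (1 : ℝ) ≤ (n : ℝ) + 1 := by linarith [(Nat.cast_nonneg n : (0 : ℝ) ≤ n)]
  have hcard : Fintype.card (SimpleGraph (Fin (n + 1))) ≤ 2 ^ (n * (n + 1)) := by
    rw [Fintype.card_of_bijective (bijective_upperBits n)]
    simp only [Fintype.card_pi, Fintype.card_bool, Finset.prod_const, Finset.card_univ]
    refine Nat.pow_le_pow_right (by norm_num) ((Fintype.card_subtype_le _).trans_eq ?_)
    simp
  have h1 : 2 * (Fintype.card (SimpleGraph (Fin (n + 1))) : ℝ) ≤ 2 ^ ((n + 1) ^ 2) := by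
    have : 2 * Fintype.card (SimpleGraph (Fin (n + 1))) ≤ 2 ^ ((n + 1) ^ 2) :=
      calc 2 * Fintype.card (SimpleGraph (Fin (n + 1))) ≤ 2 * 2 ^ (n * (n + 1)) :=
            Nat.mul_le_mul_left 2 hcard
        _ = 2 ^ (n * (n + 1) + 1) := by rw [pow_succ, mul_comm]
        _ ≤ _ := Nat.pow_le_pow_right (by norm_num) (by nlinarith)
    exact_mod_cast this
  have h2 : (2 : ℝ) ^ ((n + 1) ^ 2) < Real.exp (((n : ℝ) + 1) ^ 2) := by
    have h : ((n : ℝ) + 1) ^ 2 = ((n + 1) ^ 2 : ℕ) * 1 := by push_cast; ring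
    rw [h, Real.exp_nat_mul]
    exact pow_lt_pow_left₀ (by linarith [Real.exp_one_gt_d9]) (by norm_num) (by positivity)
  have h3 : ((n : ℝ) + 1) ^ 4 ≤ (Fintype.card (Fin (seedCoins n) → Bool) : ℕ) := by
    have := le_two_pow_seedCoins n
    simp only [Fintype.card_pi, Fintype.card_bool, Finset.prod_const, Finset.card_univ,
      Fintype.card_fin]
    exact_mod_cast this
  have h4 : ((n : ℝ) + 1) ^ 2 ≤ 2 * (Fintype.card (Fin (seedCoins n) → Bool) : ℕ) *
      (1 / √((n : ℝ) + 1)) ^ 2 := by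
    rw [div_pow, Real.sq_sqrt hN.le, one_pow, mul_one_div, le_div_iff₀ hN]
    nlinarith [pow_le_pow_right₀ hN1 (show 3 ≤ 4 by norm_num)]
  rw [Real.exp_neg, ← div_eq_mul_inv, div_lt_one (Real.exp_pos _)]
  exact (h1.trans_lt h2).trans_le (Real.exp_le_exp.2 h4)

/-- Once the seed is fixed, every input bit of the certifier is a constant or a function of one
adjacency bit, because the encodings of all candidates are hardwired. Hence the factor `2`; the
extra gate is the negation. -/
lemma computable_seeded {n b r s : ℕ}
    {C : (((Fin n × Fin (n + 1)) × Fin b) ⊕ Fin r → Bool) → Bool} (hC : ComputableInSize C s)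
    (enc : ℝ → Fin b → Bool) (y : Fin n → Fin (n + 1) → Option Bool → ℝ) (w : Fin r → Bool) :
    ComputableInSize (fun x : Fin (n + 1) × Fin (n + 1) → Bool =>
      !C (Sum.elim (fun q => enc (seedMatrix x y q.1.1 q.1.2 / √(n : ℝ)) q.2) w))
      (s * 2 + 1) := by
  have h := hC.subst (ι' := Fin (n + 1) × Fin (n + 1)) (c := 2)
    (fun q x => Sum.elim (fun q => enc (seedMatrix x y q.1.1 q.1.2 / √(n : ℝ)) q.2) w q)
    (fun q => ?_) one_le_two
  · exact h.not
  · rcases q with q | q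
    · by_cases hq : q.1.1.castSucc < q.1.2
      · have := ComputableInSize.ofBit (q.1.1.castSucc, q.1.2)
          (enc (y q.1.1 q.1.2 (some true) / √(n : ℝ)) q.2)
          (enc (y q.1.1 q.1.2 (some false) / √(n : ℝ)) q.2)
        convert this using 2 with x
        simp only [Sum.elim_inl, seedMatrix, if_pos hq]
        cases x (q.1.1.castSucc, q.1.2) <;> simp
      · simp only [Sum.elim_inl, seedMatrix, if_neg hq]
        exact (ComputableInSize.const _).mono one_le_two
    · exact (ComputableInSize.const _).mono one_le_two

/-- The test on graphs that runs a matrix test on matrices built from the graph and a table of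
seeds, and reverses its output. -/
def seededTest (ψ : RandPolyMatrixTest fun n => n + 1)
    (s : ∀ n, (Fin (seedCoins n) → Bool) →
      (Fin n → Fin (n + 1) → Option Bool → ℝ) × (Fin (ψ.coins n) → Bool)) : RandPolyTest where
  -- A graph on `m = n + 1` vertices gives a matrix with `n` rows; for `m = 0` the output is a
  -- default value.
  coins m := seedCoins (m - 1)
  run
    | 0, _, _ => true
    | n + 1, G, ω => !ψ.scaledRun n (seedMatrix (adjBits G) (s n ω).1, (s n ω).2)
  polyTime := by
    obtain ⟨c, hc⟩ := ψ.polyTime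
    let S : ℕ → ℕ := fun m => (2 * m) ^ 4 * (((m * m) ^ c + c) * 2 + 1 + 3 * (4 * (m + 1)) + 3) + 1
    have hS : PolyBounded S :=
      ((((PolyBounded.const 2).mul .id).pow 4).mul ((((((((PolyBounded.id.mul .id).pow c).add
        (.const c)).mul (.const 2)).add (.const 1)).add ((PolyBounded.const 3).mul
        ((PolyBounded.const 4).mul (PolyBounded.id.add (.const 1))))).add (.const 3)))).add
        (.const 1)
    have hT : PolyBounded fun m => 4 * (m + 2) :=
      (PolyBounded.const 4).mul (PolyBounded.id.add (.const 2))
    obtain ⟨c₁, h₁⟩ := hS.exists_le_pow_add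
    obtain ⟨c₂, h₂⟩ := hT.exists_le_pow_add
    refine ⟨max c₁ c₂, fun m => ⟨?_, ?_⟩⟩
    · refine (seedCoins_le _).trans (le_trans ?_ (h₂ _ (le_max_right _ _) m))
      show 4 * (m - 1 + 2) ≤ 4 * (m + 2)
      omega
    · rcases m with _ | n
      · exact ⟨_, (ComputableInSize.const true).mono
          (le_trans (by simp [S]) (h₁ _ (le_max_left _ _) 0)), fun G ω => rfl⟩
      · obtain ⟨-, -, C, hC, hrun⟩ := hc n
        refine ⟨_, (ComputableInSize.select _ fun a => computable_seeded hC (ψ.enc n) (s n a).1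
          (s n a).2).mono (le_trans ?_ (h₁ _ (le_max_left _ _) (n + 1))), fun G ω => ?_⟩
        · have e1 := two_pow_seedCoins_le n
          have e2 := seedCoins_le n
          have e3 : (n * (n + 1)) ^ c ≤ ((n + 1) * (n + 1)) ^ c :=
            Nat.pow_le_pow_left (Nat.mul_le_mul_right _ (by omega)) c
          simp only [S]
          gcongr
        · simp only [RandPolyMatrixTest.scaledRun, hrun]
          rfl

/-- The error of the seed table is uniform over graphs, so it integrates against any `P` of mass at
most one. Mass below one has to be allowed: `plantedLaw` is zero when no injection exists. -/
lemma exists_graph_test (ψ : RandPolyMatrixTest fun n => n + 1) (ρ : Bool → Measure ℝ)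
    [∀ b, IsProbabilityMeasure (ρ b)] (Q : Measure ℝ) [IsProbabilityMeasure Q] :
    ∃ φ : RandPolyTest, ∀ (n : ℕ) (P : Measure (SimpleGraph (Fin (n + 1)))) (b : Bool),
      P Set.univ ≤ 1 → φ.prob (n + 1) P b ≤
        ∫⁻ G, ((graphLaw ρ Q G).prod (coinLaw (ψ.coins n))) {x | ψ.scaledRun n x = !b} ∂P +
          ENNReal.ofReal (1 / √((n : ℝ) + 1)) := by
  classical
  have hseeds := fun n => exists_seeds
    ((Measure.pi fun _ : Fin n => Measure.pi fun _ : Fin (n + 1) => candidateLaw ρ Q).prod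
      (coinLaw (ψ.coins n)))
    (γ := SimpleGraph (Fin (n + 1))) (A := Fin (seedCoins n) → Bool)
    (fun G s => ψ.scaledRun n (seedMatrix (adjBits G) s.1, s.2))
    (fun G => (ψ.measurable_scaledRun n).comp
      (((measurable_seedMatrix _).comp measurable_fst).prodMk measurable_snd))
    (η := 1 / √((n : ℝ) + 1)) (by positivity) (seeds_suffice n)
  choose s hs using hseeds
  refine ⟨seededTest ψ s, fun n P b hP => ?_⟩
  have hfin : ∀ S : Set (SimpleGraph (Fin (n + 1)) × (Fin ((seededTest ψ s).coins (n + 1)) → Bool)),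
      MeasurableSet S := fun S => S.toFinite.measurableSet
  rw [RandPolyTest.prob, Measure.prod_apply (hfin _)]
  have hG : ∀ G, coinLaw ((seededTest ψ s).coins (n + 1))
      (Prod.mk G ⁻¹' {x | (seededTest ψ s).run (n + 1) x.1 x.2 = b}) ≤
      ((graphLaw ρ Q G).prod (coinLaw (ψ.coins n))) {x | ψ.scaledRun n x = !b} +
        ENNReal.ofReal (1 / √((n : ℝ) + 1)) := by
    intro G
    have h1 := hs n G (!b)
    have h2 : (Prod.mk G ⁻¹' {x : SimpleGraph (Fin (n + 1)) × _ |
        (seededTest ψ s).run (n + 1) x.1 x.2 = b}) = {ω : Fin (seedCoins n) → Bool |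
        ψ.scaledRun n (seedMatrix (adjBits G) (s n ω).1, (s n ω).2) = !b} := by
      ext ω
      cases b <;> simp [seededTest]
    have hpos : (0 : ℝ) < Fintype.card (Fin (seedCoins n) → Bool) := by
      exact_mod_cast Fintype.card_pos
    have h4 := prod_map_seedMatrix_apply ρ Q G (p := ψ.coins n)
      (S := {x | ψ.scaledRun n x = !b})
      (ψ.measurable_scaledRun n (MeasurableSet.singleton _))
    rw [h2]
    change coinLaw (seedCoins n) _ ≤ _
    rw [coinLaw_apply, ← h4, ← ENNReal.ofReal_toReal (measure_ne_top _ _),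
      ← ENNReal.ofReal_add ENNReal.toReal_nonneg (by positivity)]
    refine ENNReal.ofReal_le_ofReal ?_
    rw [div_le_iff₀' hpos]
    exact h1
  refine (lintegral_mono hG).trans ?_
  rw [lintegral_add_right _ measurable_const, lintegral_const]
  gcongr
  exact mul_le_of_le_one_right' hP

lemma lintegral_graphLaw_prod {n r : ℕ} (ρ : Bool → Measure ℝ) [∀ b, IsProbabilityMeasure (ρ b)]
    (Q : Measure ℝ) [IsProbabilityMeasure Q] (hρ : (2⁻¹ : ℝ≥0∞) • (ρ true + ρ false) = Q)
    {S : Set ((Fin n → Fin (n + 1) → ℝ) × (Fin r → Bool))} (hS : MeasurableSet S) :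
    ∫⁻ G, ((graphLaw ρ Q G).prod (coinLaw r)) S ∂erdosRenyi (n + 1) =
      ((Measure.pi fun _ => Measure.pi fun _ => Q).prod (coinLaw r)) S := by
  simp only [Measure.prod_apply_symm hS]
  rw [lintegral_lintegral_swap (measurable_of_finite _).aemeasurable]
  exact lintegral_congr fun ω => lintegral_graphLaw ρ Q hρ (measurable_prodMk_right hS)

lemma lintegral_plantedLaw_le {m κ : ℕ} (H : SimpleGraph (Fin κ))
    (f : SimpleGraph (Fin m) → ℝ≥0∞) {δ : ℝ≥0∞}
    (h : ∀ e : Fin κ ↪ Fin m, ∫⁻ G, f (plant H e G) ∂erdosRenyi m ≤ δ) :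
    ∫⁻ G, f G ∂plantedLaw m H ≤ δ := by
  rw [plantedLaw, lintegral_smul_measure, lintegral_finsetSum_measure]
  simp only [lintegral_map (measurable_of_finite f) (measurable_of_finite (plant H _))]
  calc _ ≤ (Fintype.card (Fin κ ↪ Fin m) : ℝ≥0∞)⁻¹ • ∑ e : Fin κ ↪ Fin m, δ := by
        gcongr with e
        exact h e
    _ = ((Fintype.card (Fin κ ↪ Fin m) : ℝ≥0∞)⁻¹ * Fintype.card (Fin κ ↪ Fin m)) * δ := by
        simp [mul_assoc]
    _ ≤ 1 * δ := by
        gcongr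
        exact ENNReal.inv_mul_le_one _
    _ = δ := one_mul δ

lemma plantedLaw_univ_le {m κ : ℕ} (H : SimpleGraph (Fin κ)) : plantedLaw m H Set.univ ≤ 1 := by
  have := lintegral_plantedLaw_le (m := m) H (fun _ => 1) (δ := 1) (by simp)
  simpa using this

/-! ### The choice of parameters -/

/-- The sparsity `⌊(n + 1) ^ γ⌋`. -/
def sparsityOf (γ : ℝ) (n : ℕ) : ℕ := ⌊((n : ℝ) + 1) ^ γ⌋₊

section Parameters

variable {γ : ℝ}

lemma one_le_cast_add_one (n : ℕ) : (1 : ℝ) ≤ (n : ℝ) + 1 := by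
  linarith [(Nat.cast_nonneg n : (0 : ℝ) ≤ n)]

lemma sparsityOf_le (γ : ℝ) (n : ℕ) : (sparsityOf γ n : ℝ) ≤ ((n : ℝ) + 1) ^ γ :=
  Nat.floor_le (by positivity)

lemma le_two_mul_sparsityOf (hγ : 0 ≤ γ) (n : ℕ) :
    ((n : ℝ) + 1) ^ γ ≤ 2 * sparsityOf γ n := by
  have h1 : 1 ≤ ((n : ℝ) + 1) ^ γ := Real.one_le_rpow (one_le_cast_add_one n) hγ
  have h2 : (1 : ℝ) ≤ sparsityOf γ n := by
    exact_mod_cast Nat.le_floor (by exact_mod_cast h1)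
  have h3 := Nat.lt_floor_add_one (((n : ℝ) + 1) ^ γ)
  change _ < (sparsityOf γ n : ℝ) + 1 at h3
  linarith

lemma one_le_sparsityOf (hγ : 0 ≤ γ) (n : ℕ) : 1 ≤ sparsityOf γ n :=
  Nat.le_floor (by exact_mod_cast Real.one_le_rpow (one_le_cast_add_one n) hγ)

lemma sparsityOf_le_add_one (hγ : γ ≤ 1) (n : ℕ) : sparsityOf γ n ≤ n + 1 := by
  have h := (sparsityOf_le γ n).trans (Real.rpow_le_rpow_of_exponent_le (one_le_cast_add_one n) hγ)
  rw [Real.rpow_one] at h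
  exact_mod_cast h

lemma tendsto_cast_add_one : Tendsto (fun n : ℕ => (n : ℝ) + 1) atTop atTop :=
  tendsto_atTop_add_const_right _ _ tendsto_natCast_atTop_atTop

lemma tendsto_sparsityOf (hγ : 0 < γ) : Tendsto (sparsityOf γ) atTop atTop :=
  tendsto_nat_floor_atTop.comp ((tendsto_rpow_atTop hγ).comp tendsto_cast_add_one)

/-- Up to the logarithm the required sample size is `n ^ β` with `β = (1/2 - δ)(1 + α) + 6δ = 1 - 2δ
- δ(1 + α) < 1`. -/
lemma inRegime_sparsityOf {α δ : ℝ} (hα₀ : 0 ≤ α) (hδ : 0 < δ) (hδα : 16 * δ = 1 - α) :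
    InRegime α (fun n => n + 1) (sparsityOf (1 / 2 - δ))
      fun n => ((n : ℝ) + 1) ^ (-(3 * δ)) / 2 where
  sparsity n := ⟨one_le_sparsityOf (by linarith) n, sparsityOf_le_add_one (by linarith) n⟩
  distortion n := by
    have h : ((n : ℝ) + 1) ^ (-(3 * δ)) ≤ 1 :=
      Real.rpow_le_one_of_one_le_of_nonpos (one_le_cast_add_one n) (by linarith)
    exact ⟨by positivity, by linarith⟩
  tendsto_p := tendsto_add_atTop_nat 1
  tendsto_k := tendsto_sparsityOf (by linarith)
  sampleSize := by
    set β : ℝ := (1 / 2 - δ) * (1 + α) + 6 * δ with hβ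
    have hβ1 : 0 < 1 - β := by
      have : 0 ≤ δ * (1 + α) := by positivity
      rw [hβ]
      nlinarith
    have h1 : (fun x : ℝ => x ^ β * Real.log x) =o[atTop] fun x : ℝ => x := by
      have h := (isBigO_refl (fun x : ℝ => x ^ β) atTop).mul_isLittleO
        (isLittleO_log_rpow_atTop hβ1)
      refine h.congr' EventuallyEq.rfl ?_
      filter_upwards [eventually_gt_atTop 0] with x hx
      rw [← Real.rpow_add hx]
      simp
    have h2 : (fun n : ℕ => ((n : ℝ) + 1) ^ β * Real.log ((n : ℝ) + 1)) =o[atTop]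
        fun n : ℕ => (n : ℝ) := by
      refine (h1.comp_tendsto tendsto_cast_add_one).trans_isBigO ?_
      refine IsBigO.of_bound 2 ?_
      filter_upwards [eventually_ge_atTop 1] with n hn
      have : (1 : ℝ) ≤ n := by exact_mod_cast hn
      simp only [Function.comp_apply, Real.norm_eq_abs]
      rw [abs_of_nonneg (by linarith), abs_of_nonneg (by linarith)]
      linarith
    refine IsBigO.trans_isLittleO (IsBigO.of_bound 4 (Eventually.of_forall fun n => ?_)) h2
    have hN : (0 : ℝ) < (n : ℝ) + 1 := by positivity
    have hlog : 0 ≤ Real.log ((n : ℝ) + 1) := Real.log_nonneg (one_le_cast_add_one n)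
    have hθ : (((n : ℝ) + 1) ^ (-(3 * δ)) / 2) ^ 2 = ((n : ℝ) + 1) ^ (-(6 * δ)) / 4 := by
      rw [div_pow, ← Real.rpow_natCast, ← Real.rpow_mul hN.le]
      norm_num
      ring_nf
    have hk : (sparsityOf (1 / 2 - δ) n : ℝ) ^ (1 + α) ≤
        ((n : ℝ) + 1) ^ ((1 / 2 - δ) * (1 + α)) := by
      rw [Real.rpow_mul hN.le]
      exact Real.rpow_le_rpow (by positivity) (sparsityOf_le _ n) (by linarith)
    have hcast : ((n + 1 : ℕ) : ℝ) = (n : ℝ) + 1 := by push_cast; rfl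
    rw [hcast, hθ, Real.norm_of_nonneg (by positivity), Real.norm_of_nonneg (by positivity),
      div_le_iff₀ (by positivity)]
    calc _ ≤ ((n : ℝ) + 1) ^ ((1 / 2 - δ) * (1 + α)) * Real.log ((n : ℝ) + 1) := by gcongr
      _ = ((n : ℝ) + 1) ^ β * ((n : ℝ) + 1) ^ (-(6 * δ)) * Real.log ((n : ℝ) + 1) := by
        rw [← Real.rpow_add hN]
        congr 2
        rw [hβ]
        ring
      _ = _ := by ring

lemma tendsto_rpow_neg_cast_add_one {a : ℝ} (ha : a < 0) :
    Tendsto (fun n : ℕ => ((n : ℝ) + 1) ^ a) atTop (𝓝 0) := by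
  have := (tendsto_rpow_neg_atTop (neg_pos.2 ha)).comp tendsto_cast_add_one
  simpa [Function.comp_def] using this

lemma tendsto_cast_sparsityOf (hγ : 0 < γ) :
    Tendsto (fun n => (sparsityOf γ n : ℝ)) atTop atTop :=
  tendsto_natCast_atTop_atTop.comp (tendsto_sparsityOf hγ)

/-- After division by `κ`, the signal `κ² ≈ n^(1 - 2δ)` beats `n θ ≈ n^(1 - 3δ)`, which dictates the
exponent of `θ`. The term `κ²` is the mean lost by dropping the rows of the block. -/
lemma eventually_signal {δ : ℝ} (hδ : 0 < δ) (hδ' : δ < 1 / 2) {A : ℝ} (hA : 0 < A) :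
    ∀ᶠ n : ℕ in atTop, (n : ℝ) * sparsityOf (1 / 2 - δ) n * (((n : ℝ) + 1) ^ (-(3 * δ)) / 2) +
      (sparsityOf (1 / 2 - δ) n : ℝ) ^ 2 ≤ A / 2 * (sparsityOf (1 / 2 - δ) n : ℝ) ^ 3 := by
  have hγ : 0 < 1 / 2 - δ := by linarith
  have h1 := (tendsto_rpow_neg_cast_add_one (neg_neg_iff_pos.2 hδ)).eventually
    (ge_mem_nhds (show (0 : ℝ) < A / 8 by positivity))
  filter_upwards [h1, (tendsto_cast_sparsityOf hγ).eventually_ge_atTop (4 / A)] with n h1 h2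
  have hN : (0 : ℝ) < (n : ℝ) + 1 := by positivity
  set κ : ℝ := (sparsityOf (1 / 2 - δ) n : ℝ) with hκ
  have hκ0 : 0 ≤ κ := Nat.cast_nonneg _
  have h3 : ((n : ℝ) + 1) ^ (1 - 2 * δ) ≤ 4 * κ ^ 2 := by
    have h := pow_le_pow_left₀ (by positivity) (le_two_mul_sparsityOf hγ.le n) 2
    rw [← Real.rpow_natCast, ← Real.rpow_mul hN.le] at h
    refine le_trans (le_of_eq ?_) (h.trans_eq (by ring))
    congr 1
    push_cast
    ring
  have h4 : (n : ℝ) * ((n : ℝ) + 1) ^ (-(3 * δ)) ≤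
      ((n : ℝ) + 1) ^ (1 - 2 * δ) * ((n : ℝ) + 1) ^ (-δ) := by
    rw [← Real.rpow_add hN, show 1 - 2 * δ + -δ = 1 + -(3 * δ) by ring, Real.rpow_add hN,
      Real.rpow_one]
    gcongr
    linarith
  have h5 : (n : ℝ) * ((n : ℝ) + 1) ^ (-(3 * δ)) ≤ 4 * κ ^ 2 * (A / 8) :=
    h4.trans (mul_le_mul h3 h1 (by positivity) (by positivity))
  have h6 : κ ^ 2 ≤ A / 4 * κ ^ 3 := by
    rw [div_le_iff₀ hA] at h2
    nlinarith [sq_nonneg κ]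
  nlinarith [mul_le_mul_of_nonneg_left h5 hκ0]

/-- This is the Chebyshev ratio of variance `n κ²` to squared signal `κ⁶`, of order `n^(4δ - 1)`. -/
lemma tendsto_cast_div_sparsityOf_pow {δ : ℝ} (hδ' : δ < 1 / 4) :
    Tendsto (fun n : ℕ => (n : ℝ) / (sparsityOf (1 / 2 - δ) n : ℝ) ^ 4) atTop (𝓝 0) := by
  have h := (tendsto_rpow_neg_cast_add_one (a := 4 * δ - 1) (by linarith)).const_mul 16
  rw [mul_zero] at h
  refine squeeze_zero (fun n => by positivity) (fun n => ?_) h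
  have hN : (0 : ℝ) < (n : ℝ) + 1 := by positivity
  have hγ : 0 < 1 / 2 - δ := by linarith
  have h1 : (1 : ℝ) ≤ sparsityOf (1 / 2 - δ) n := by exact_mod_cast one_le_sparsityOf hγ.le n
  have h3 : ((n : ℝ) + 1) ^ (2 - 4 * δ) ≤ 16 * (sparsityOf (1 / 2 - δ) n : ℝ) ^ 4 := by
    have h := pow_le_pow_left₀ (by positivity) (le_two_mul_sparsityOf hγ.le n) 4
    rw [← Real.rpow_natCast, ← Real.rpow_mul hN.le] at h
    refine le_trans (le_of_eq ?_) (h.trans_eq (by ring))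
    congr 1
    push_cast
    ring
  rw [div_le_iff₀ (by positivity)]
  calc (n : ℝ) ≤ ((n : ℝ) + 1) ^ (4 * δ - 1) * ((n : ℝ) + 1) ^ (2 - 4 * δ) := by
        rw [← Real.rpow_add hN, show 4 * δ - 1 + (2 - 4 * δ) = 1 by ring, Real.rpow_one]
        linarith
    _ ≤ ((n : ℝ) + 1) ^ (4 * δ - 1) * (16 * (sparsityOf (1 / 2 - δ) n : ℝ) ^ 4) := by gcongr
    _ = _ := by ring

end Parameters

/-! ### The reduction -/

/-- A sound matrix test rarely accepts a matrix built from a planted dense graph. -/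
lemma lintegral_scaledRun_plantedLaw_le {n : ℕ} (hn : 0 < n) {ρ : Bool → Measure ℝ}
    [∀ b, IsProbabilityMeasure (ρ b)] {Q : Measure ℝ} [IsProbabilityMeasure Q]
    {s : ℝ≥0} (hQ : HasSubgaussianMGF id s Q) (hQ0 : ∫ x, x ∂Q = 0) (hQ1 : Var[id; Q] = 1)
    (hρ : (2⁻¹ : ℝ≥0∞) • (ρ true + ρ false) = Q) {c : ℝ} (hc : 0 < c)
    (h1 : ∫ x, x ∂ρ true = c) (h0 : ∫ x, x ∂ρ false = -c) {κ : ℕ} (hκ : 2 ≤ κ) {ε θ : ℝ}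
    (hε : 0 < ε) {t : ℝ} (ht : 0 < t)
    (htκ : n * κ * (1 + θ) ≤ (n - κ) * κ - t + (c * ε * (κ * (κ - 1))) ^ 2 / (4 * κ))
    {H : SimpleGraph (Fin κ)} (hH : H ∈ denseGraphs κ ε)
    (ψ : RandPolyMatrixTest fun n => n + 1)
    (hsound : ∀ X ω, ψ.run n X ω = true → RIP κ θ X) :
    ∫⁻ G, ((graphLaw ρ Q G).prod (coinLaw (ψ.coins n))) {x | ψ.scaledRun n x = true}
      ∂plantedLaw (n + 1) H ≤
      ENNReal.ofReal (n * (48 * Real.exp (s / 2) * κ ^ 2) / t ^ 2) +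
        ENNReal.ofReal (8 * κ ^ 2 / (c * ε * (κ * (κ - 1))) ^ 2) := by
  -- Soundness holds for every outcome of the coins, so acceptance under some outcome already
  -- implies the restricted isometry property.
  set B : Set (Fin n → Fin (n + 1) → ℝ) := ⋃ ω, {Z | ψ.scaledRun n (Z, ω) = true} with hB
  have hBm : MeasurableSet B := MeasurableSet.iUnion fun ω =>
    ((ψ.measurable_scaledRun n).comp (measurable_id.prodMk measurable_const))
      (MeasurableSet.singleton true)
  refine lintegral_plantedLaw_le H _ fun e => le_trans (lintegral_mono fun G => ?_)
    (lintegral_graphLaw_plant_le hn hQ hQ0 hQ1 hρ hc h1 h0 hκ hε ht htκ hH e hBm fun Z hZ => ?_)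
  · refine (measure_mono (t := B ×ˢ Set.univ) fun x hx =>
      ⟨Set.mem_iUnion.2 ⟨x.2, hx⟩, Set.mem_univ _⟩).trans_eq ?_
    rw [Measure.prod_prod, measure_univ, mul_one]
  · obtain ⟨ω, hω⟩ := Set.mem_iUnion.1 hZ
    exact hsound _ ω hω

/-- A certifier yields a test that detects planted dense graphs. -/
lemma not_plantedDenseHardness {ε δ : ℝ} (hε : 0 < ε) (hδ : 0 < δ) (hδ' : δ < 1 / 4) {σ : ℝ≥0}
    {Q : Measure ℝ} (hQ : Q ∈ subGaussianClass σ) (ψ : RandPolyMatrixTest fun n => n + 1)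
    (hψ : IsCertifier Q (fun n => n + 1) (sparsityOf (1 / 2 - δ))
      (fun n => ((n : ℝ) + 1) ^ (-(3 * δ)) / 2) ψ) : ¬ PlantedDenseHardness ε := by
  intro hA
  obtain ⟨hQp, hQ0, hQ1, hQs⟩ := hQ
  obtain ⟨ρ, hρp, hρ, c, hc, h1, h0⟩ := exists_tilt Q hQs.integrable hQ0 (by rw [hQ1]; simp)
  obtain ⟨φ, hφ⟩ := exists_graph_test ψ ρ Q
  set k := sparsityOf (1 / 2 - δ) with hk
  have hγ : 0 < 1 / 2 - δ := by linarith
  have hkt : Tendsto (fun n => (k n : ℝ)) atTop atTop := tendsto_cast_sparsityOf hγ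
  have hlt := hA δ hδ (by linarith) (fun m => k (m - 1))
    ((tendsto_sparsityOf hγ).comp (tendsto_sub_atTop_nat 1)) (by
      refine IsBigO.of_bound 1 ?_
      filter_upwards [eventually_ge_atTop 1] with m hm
      have h := sparsityOf_le (1 / 2 - δ) (m - 1)
      have hm' : ((m - 1 : ℕ) : ℝ) + 1 = m := by
        rw [Nat.cast_sub hm]; push_cast; ring
      rw [hm'] at h
      rw [one_mul, Real.norm_of_nonneg (by positivity), Real.norm_of_nonneg (by positivity)]
      exact h) φ
  rw [← liminf_nat_add _ 1] at hlt
  refine absurd hlt (not_lt.2 ?_)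
  -- As `κ - 1 ≥ κ / 2`, the block contributes at least `A κ³`. One half absorbs the deviation `t`,
  -- the other half beats the allowance in `eventually_signal`.
  set A : ℝ := (c * ε) ^ 2 / 16 with hA'
  have hApos : 0 < A := by positivity
  -- The terms are the Chebyshev errors outside and inside the block, and the seed error incurred
  -- once under the null law and once under the planted law.
  let r : ℕ → ℝ := fun n => 192 * Real.exp (↑(σ ^ 2) / 2) / A ^ 2 * (n / (k n : ℝ) ^ 4) +
    8 / (c * ε) ^ 2 * (1 / ((k n : ℝ) - 1) ^ 2) + 2 * (1 / √((n : ℝ) + 1))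
  have hr : Tendsto r atTop (𝓝 0) := by
    have e1 := (tendsto_cast_div_sparsityOf_pow hδ').const_mul
      (192 * Real.exp (↑(σ ^ 2) / 2) / A ^ 2)
    have e2 : Tendsto (fun n => 8 / (c * ε) ^ 2 * (1 / ((k n : ℝ) - 1) ^ 2)) atTop
        (𝓝 (8 / (c * ε) ^ 2 * 0)) := by
      refine Tendsto.const_mul _ ?_
      simp only [one_div]
      exact tendsto_inv_atTop_zero.comp ((tendsto_pow_atTop two_ne_zero).comp
        (tendsto_atTop_add_const_right _ (-1) hkt))
    have e3 : Tendsto (fun n : ℕ => 2 * (1 / √((n : ℝ) + 1))) atTop (𝓝 (2 * 0)) := by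
      refine Tendsto.const_mul _ ?_
      simp only [one_div]
      exact tendsto_inv_atTop_zero.comp (Real.tendsto_sqrt_atTop.comp tendsto_cast_add_one)
    have e := (e1.add e2).add e3
    simp only [mul_zero, add_zero] at e
    exact e
  let D : ℕ → ℝ≥0∞ := fun n => ((designLaw Q n (n + 1)).prod (coinLaw (ψ.coins n)))
    {x | ψ.run n (Matrix.of x.1) x.2 = false}
  have hD : limsup D atTop ≤ 1 / 3 := hψ.complete
  have hle : ∀ᶠ n in atTop, φ.prob (n + 1) (erdosRenyi (n + 1)) true +
      ⨆ H ∈ denseGraphs (k (n + 1 - 1)) ε, φ.prob (n + 1) (plantedLaw (n + 1) H) false ≤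
      D n + ENNReal.ofReal (r n) := by
    filter_upwards [eventually_signal hδ (by linarith) hApos, hkt.eventually_ge_atTop 2,
      eventually_gt_atTop 0] with n hsig hk2 hn
    have hk2' : 2 ≤ k n := by exact_mod_cast hk2
    have e1 : φ.prob (n + 1) (erdosRenyi (n + 1)) true ≤
        D n + ENNReal.ofReal (1 / √((n : ℝ) + 1)) := by
      refine (hφ n _ true prob_le_one).trans ?_
      refine le_of_eq (congrArg (· + _) ?_)
      exact (lintegral_graphLaw_prod ρ Q hρ (S := {x | ψ.scaledRun n x = false})
        (ψ.measurable_scaledRun n (MeasurableSet.singleton _))).trans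
        (designLaw_prod_apply Q ψ n false).symm
    have hκ0 : (0 : ℝ) < k n := by linarith
    have hκ1 : (0 : ℝ) < (k n : ℝ) - 1 := by linarith
    have ht : 0 < A / 2 * (k n : ℝ) ^ 3 := by positivity
    have e2 : ∀ H ∈ denseGraphs (k n) ε, φ.prob (n + 1) (plantedLaw (n + 1) H) false ≤
        ENNReal.ofReal (n * (48 * Real.exp (↑(σ ^ 2) / 2) * (k n) ^ 2) /
          (A / 2 * (k n : ℝ) ^ 3) ^ 2) +
        ENNReal.ofReal (8 * (k n) ^ 2 / (c * ε * (k n * (k n - 1))) ^ 2) +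
        ENNReal.ofReal (1 / √((n : ℝ) + 1)) := by
      intro H hH
      refine (hφ n _ false (plantedLaw_univ_le H)).trans (add_le_add_left ?_ _)
      refine lintegral_scaledRun_plantedLaw_le hn hQs hQ0 hQ1 hρ hc h1 h0 hk2' hε ht ?_ hH ψ
        (hψ.sound n)
      have e3 : (c * ε * (k n * (k n - 1))) ^ 2 / (4 * k n) =
          4 * A * (k n : ℝ) * ((k n : ℝ) - 1) ^ 2 := by
        rw [hA']
        field_simp
        ring
      have e4 : A * (k n : ℝ) ^ 3 ≤ 4 * A * (k n : ℝ) * ((k n : ℝ) - 1) ^ 2 := by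
        have : (k n : ℝ) ^ 2 ≤ 4 * ((k n : ℝ) - 1) ^ 2 := by nlinarith
        have := mul_le_mul_of_nonneg_left this (mul_pos hApos hκ0).le
        nlinarith
      rw [e3]
      linarith
    have e5 : n * (48 * Real.exp (↑(σ ^ 2) / 2) * (k n : ℝ) ^ 2) / (A / 2 * (k n : ℝ) ^ 3) ^ 2 =
        192 * Real.exp (↑(σ ^ 2) / 2) / A ^ 2 * (n / (k n : ℝ) ^ 4) := by
      field_simp
      ring
    have e6 : 8 * (k n : ℝ) ^ 2 / (c * ε * (k n * (k n - 1))) ^ 2 =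
        8 / (c * ε) ^ 2 * (1 / ((k n : ℝ) - 1) ^ 2) := by
      field_simp
    refine (add_le_add e1 (iSup₂_le e2)).trans_eq ?_
    rw [e5, e6, add_assoc, ← ENNReal.ofReal_add (by positivity) (by positivity),
      ← ENNReal.ofReal_add (by positivity) (by positivity),
      ← ENNReal.ofReal_add (by positivity) (by positivity)]
    congr 2
    simp only [r]
    ring
  calc _ ≤ limsup (fun n => D n + ENNReal.ofReal (r n)) atTop :=
        (liminf_le_liminf hle).trans liminf_le_limsup
    _ = limsup D atTop := by
        have h := ENNReal.tendsto_ofReal hr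
        rw [ENNReal.ofReal_zero] at h
        exact ENNReal.limsup_add_of_right_tendsto_zero h D
    _ ≤ 1 / 3 := hD

end RIPHardness

end

theorem theorem1 (ε : ℝ) (hε₀ : 0 < ε) (hε₁ : ε ≤ 1 / 2)
    (hA1 : RIPHardness.PlantedDenseHardness ε)
    (σ : ℝ≥0) (α : ℝ) (hα₀ : 0 ≤ α) (hα₁ : α < 1) :
    ∃ (p k : ℕ → ℕ) (θ : ℕ → ℝ), RIPHardness.InRegime α p k θ ∧
      ¬ ∃ (ψ : RIPHardness.RandPolyMatrixTest p) (Q : Measure ℝ),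
        Q ∈ RIPHardness.subGaussianClass σ ∧ RIPHardness.IsCertifier Q p k θ ψ := by
  have hδ : 0 < (1 - α) / 16 := by linarith
  refine ⟨_, _, _, RIPHardness.inRegime_sparsityOf hα₀ hδ (by ring), ?_⟩
  rintro ⟨ψ, Q, hQ, hψ⟩
  exact RIPHardness.not_plantedDenseHardness hε₀ hδ (by linarith) hQ ψ hψ hA1
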